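/- Let $d\ge 1$ be an integer, let $\beta=s+r$ with $s\in\mathbb{N}_0=\{0,1,2,\dots\}$ and $r\in(0,1]$ (so $s$ is the largest integer strictly smaller than $\beta$), and let $B_0>0$. Let $\mathcal{H}^\beta([0,1]^d,B_0)$ be the class of functions $f:[0,1]^d\to\mathbb{R}$ of class $C^s$ (with one-sided derivatives at the boundary) such that $$\max_{\|\alpha\|_1\le s}\ \sup_{x\in[0,1]^d}|\partial^\alpha f(x)|\le B_0,\qquad \max_{\|\alpha\|_1=s}\ \sup_{x\ne y}\frac{|\partial^\alpha f(x)-\partial^\alpha f(y)|}{\|x-y\|_2^{r}}\le B_0,$$ where $\alpha\in\mathbb{N}_0^d$, $\|\alpha\|_1=\sum_{i=1}^d\alpha_i$ and $\partial^\alpha=\partial_1^{\alpha_1}\cdots\partial_d^{\alpha_d}$. A ReLU network with depth $\mathcal{D}$ and width $\mathcal{W}$ is a function $\phi=\mathcal{L}_{\mathcal{D}}\circ\sigma\circ\mathcal{L}_{\mathcal{D}-1}\circ\sigma\circ\cdots\circ\sigma\circ\mathcal{L}_0:\mathbb{R}^d\to\mathbb{R}$, where $\mathcal{L}_i:\mathbb{R}^{p_i}\to\mathbb{R}^{p_{i+1}}$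 are affine maps, $p_0=d$, $p_{\mathcal{D}+1}=1$, $\sigma(t)=\max(0,t)$ acts componentwise, and $\mathcal{W}=\max\{p_1,\dots,p_{\mathcal{D}}\}$. Let $f\in\mathcal{H}^\beta([0,1]^d,B_0)$. Then for all positive integers $M,N$ there exists a function $\phi$ implemented by a ReLU network with width $$\mathcal{W}=38(s+1)^2\,3^d\,d^{\,s+1}N\lceil\log_2(8N)\rceil$$ and depth $$\mathcal{D}=21(s+1)^2M\lceil\log_2(8M)\rceil+2d$$ such that for every $x\in[0,1]^d$ $$|f(x)-\phi(x)|\le 19\,B_0\,(s+1)^2\,d^{\,s+\max\{\beta,1\}/2}\,(NM)^{-2\beta/d}.$$ -/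

import Mathlib

noncomputable section

/-- The closed unit cube `[0,1]^d` in Euclidean space. -/
def unitCube (d : ℕ) : Set (EuclideanSpace ℝ (Fin d)) :=
  {x | ∀ i, x i ∈ Set.Icc (0 : ℝ) 1}

/-- The `i`-th first order partial derivative `∂ᵢ g` of a function on `[0,1]^d`
(one-sided at the boundary faces `xᵢ = 0` and `xᵢ = 1`). It depends only on the values of `g`
on the cube. -/
def cubePartial {d : ℕ} (i : Fin d) (g : EuclideanSpace ℝ (Fin d) → ℝ) :
    EuclideanSpace ℝ (Fin d) → ℝ :=
  fun x => lineDerivWithin ℝ g (unitCube d) x (EuclideanSpace.single i (1 : ℝ))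

/-- The partial derivative `∂^α f = ∂₁^{α₁} ⋯ ∂_d^{α_d} f` on `[0,1]^d`. -/
def cubeDeriv {d : ℕ} (α : Fin d → ℕ) (f : EuclideanSpace ℝ (Fin d) → ℝ) :
    EuclideanSpace ℝ (Fin d) → ℝ :=
  (List.finRange d).foldr (fun i g => (cubePartial i)^[α i] g) f

/-- The Hölder class `ℋ^β([0,1]^d, B₀)` with `β = s + r`, `s ∈ ℕ`, `r ∈ (0,1]`: functions of
class `C^s` on `[0,1]^d` all of whose partial derivatives of order at most `s` are bounded by
`B₀`, those of order exactly `s` being `r`-Hölder for the Euclidean norm with constant `B₀`.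
Only the values on the cube matter. -/
def holderClass (d s : ℕ) (r B₀ : ℝ) : Set (EuclideanSpace ℝ (Fin d) → ℝ) :=
  {f | ContDiffOn ℝ s f (unitCube d) ∧
    (∀ α : Fin d → ℕ, ∑ i, α i ≤ s → ∀ x ∈ unitCube d, |cubeDeriv α f x| ≤ B₀) ∧
    (∀ α : Fin d → ℕ, ∑ i, α i = s → ∀ x ∈ unitCube d, ∀ y ∈ unitCube d,
      |cubeDeriv α f x - cubeDeriv α f y| ≤ B₀ * ‖x - y‖ ^ r)}

/-- Fully connected ReLU networks with `m` inputs and `n` outputs: either a single affine map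
`x ↦ A x + b` (no hidden layer), or a first hidden layer with `k` neurons computing
`σ(A x + b)`, followed by a network with `k` inputs. -/
inductive ReLUNet (n : ℕ) : ℕ → Type
  | affine {m : ℕ} (A : Matrix (Fin n) (Fin m) ℝ) (b : Fin n → ℝ) : ReLUNet n m
  | layer {m k : ℕ} (A : Matrix (Fin k) (Fin m) ℝ) (b : Fin k → ℝ) (rest : ReLUNet n k) :
      ReLUNet n m

namespace ReLUNet

/-- The function computed by a network; `σ(t) = max(0, t)` acts componentwise. -/
def eval {n : ℕ} : {m : ℕ} → ReLUNet n m → (Fin m → ℝ) → (Fin n → ℝ)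
  | _, affine A b, x => A.mulVec x + b
  | _, layer A b rest, x => rest.eval (fun j => max 0 ((A.mulVec x + b) j))

/-- The number of hidden layers. -/
def depth {n : ℕ} : {m : ℕ} → ReLUNet n m → ℕ
  | _, affine _ _ => 0
  | _, layer _ _ rest => rest.depth + 1

/-- The maximal number of neurons in a hidden layer. -/
def width {n : ℕ} : {m : ℕ} → ReLUNet n m → ℕ
  | _, affine _ _ => 0
  | _, layer (k := k) _ _ rest => max k rest.width

end ReLUNet

end

/-! Cut the cube into `K ^ d` cells, where `K` is the largest power of two with `K ^ d ≤ (N * M) ^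
2`. On a cell, `f` differs from its Taylor polynomial of degree `s` at the lower corner by a
constant times `K ^ (-β)`, hence by a constant times `(N * M) ^ (-2β/d)` (`abs_sub_taylor_sum_le`).
A network therefore has to find the cell of a point and the offset inside it, and to read the Taylor
coefficients from a table of about `(N * M) ^ 2` rows, although width and depth are only about `N`
and `M` up to logarithms.

The table is read by `reach_fetch`. The cell number is split into `a, b < 2 ^ ν` and `v, w < 2 ^ μ`,
with `2 ^ ν` of order `N` and `2 ^ μ` of order `M`. Once `a` is known in unary, any function of it
is an affine map and costs nothing; `b` is selected by one neuron per value; `v` is scanned layer by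
layer; and the entries for all values of `w` are packed into the bits of one real number, which are
extracted one after another. Each of width and depth is thus used twice, which produces the square.

All arithmetic on rounded data is exact. A coordinate is rounded to a multiple of `1 / P`, so that
an offset has finitely many base `R` digits, and a number in `[0, 1]` is multiplied by a digit
through gates `relu (z + indicator - 1)` (`reach_mul`). Only three errors remain: the Taylor
remainder, the rounding of the coefficients to finitely many bits, and the rounding of the point.

Digits are discontinuous, so the construction is correct only where no coordinate lies just below a
multiple of `1 / P`. Shifting a coordinate by `±1 / (4P)` makes at least two of the three resulting
values good, and a median lies in any interval that contains two of its arguments. Medians taken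
coordinate by coordinate (`exists_median_network`) remove the exceptional set, at the price of a
factor `3 ^ d` in width and `2 * d` further layers. -/

namespace ReLUCalculus

-- Affine spans and computability by layers of bounded width

universe u

variable {X : Type u}

/-- Pointwise positive part of a real function. -/
def relu (g : X → ℝ) : X → ℝ := fun x => max 0 (g x)

/-- The affine combinations of a set of real functions. -/
def affSpan (S : Set (X → ℝ)) : Submodule ℝ (X → ℝ) := Submodule.span ℝ (insert 1 S)

section affSpan

variable {S T : Set (X → ℝ)} {f g : X → ℝ}

lemma subset_affSpan : S ⊆ affSpan S :=
  (Set.subset_insert _ _).trans Submodule.subset_span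

lemma aff_mem (h : f ∈ S) : f ∈ affSpan S := subset_affSpan h

lemma aff_const (c : ℝ) : (fun _ => c : X → ℝ) ∈ affSpan S := by
  have : (fun _ => c : X → ℝ) = c • (1 : X → ℝ) := by ext; simp
  rw [this]
  exact Submodule.smul_mem _ _ (Submodule.subset_span (Set.mem_insert _ _))

lemma aff_add (hf : f ∈ affSpan S) (hg : g ∈ affSpan S) : (fun x => f x + g x) ∈ affSpan S :=
  add_mem hf hg

lemma aff_sub (hf : f ∈ affSpan S) (hg : g ∈ affSpan S) : (fun x => f x - g x) ∈ affSpan S :=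
  sub_mem hf hg

lemma aff_mul (c : ℝ) (hf : f ∈ affSpan S) : (fun x => c * f x) ∈ affSpan S :=
  Submodule.smul_mem _ c hf

lemma aff_sum {ι : Type*} (s : Finset ι) {F : ι → X → ℝ} (h : ∀ i ∈ s, F i ∈ affSpan S) :
    (fun x => ∑ i ∈ s, F i x) ∈ affSpan S := by
  have : (fun x => ∑ i ∈ s, F i x) = ∑ i ∈ s, F i := by ext; simp
  rw [this]
  exact sum_mem h

lemma affSpan_le (h : S ⊆ affSpan T) : affSpan S ≤ affSpan T := by
  refine Submodule.span_le.2 (Set.insert_subset ?_ h)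
  exact aff_const 1

lemma affSpan_mono (h : S ⊆ T) : affSpan S ≤ affSpan T := affSpan_le (h.trans subset_affSpan)

lemma exists_of_mem_affSpan_range {ι : Type*} [Fintype ι] {e : ι → X → ℝ}
    (h : f ∈ affSpan (Set.range e)) :
    ∃ (a : ι → ℝ) (c : ℝ), ∀ x, f x = (∑ i, a i * e i x) + c := by
  obtain ⟨c, z, hz, rfl⟩ := Submodule.mem_span_insert.1 h
  obtain ⟨a, rfl⟩ := (Submodule.mem_span_range_iff_exists_fun ℝ).1 hz
  refine ⟨a, c, fun x => ?_⟩
  simp [add_comm]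

/-- Affine combinations commute with a change of the base type. -/
lemma comp_mem_affSpan {Y : Type*} (π : Y → X) (hf : f ∈ affSpan S) :
    f ∘ π ∈ affSpan ((fun g => g ∘ π) '' S) := by
  induction hf using Submodule.span_induction with
  | mem g hg =>
    rcases hg with rfl | hg
    · exact aff_const 1
    · exact aff_mem ⟨g, hg, rfl⟩
  | zero => exact zero_mem _
  | add g h _ _ hg hh => exact add_mem hg hh
  | smul c g _ hg => exact Submodule.smul_mem _ c hg

end affSpan

/-- `Reach S W D T`: all functions in `T` can be computed from those in `S` by a ReLU network with
`D` hidden layers of at most `W` neurons each. -/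
inductive Reach (S : Set (X → ℝ)) (W : ℕ) : ℕ → Set (X → ℝ) → Prop
  | base {T : Set (X → ℝ)} (h : T ⊆ affSpan S) : Reach S W 0 T
  | step {D : ℕ} {T U V : Set (X → ℝ)} (h : Reach S W D T) (hc : U.encard ≤ W)
      (hU : ∀ g ∈ U, ∃ h ∈ affSpan T, g = relu h) (hV : V ⊆ affSpan U) : Reach S W (D + 1) V

lemma relu_eq_self {g : X → ℝ} (h : ∀ x, 0 ≤ g x) : relu g = g := by
  ext x; simp [relu, h x]

section card

variable {α : Type*} {s t : Set α} {a b c : ℕ}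

lemma encard_union_le_of_le (hs : s.encard ≤ a) (ht : t.encard ≤ b) (h : a + b ≤ c) :
    (s ∪ t).encard ≤ c := by
  refine (Set.encard_union_le s t).trans ((add_le_add hs ht).trans ?_)
  exact_mod_cast h

lemma encard_range_le {ι : Type*} [Fintype ι] (f : ι → α) (h : Fintype.card ι ≤ c) :
    (Set.range f).encard ≤ c := by
  rw [← Set.image_univ]
  refine (Set.encard_image_le _ _).trans ?_
  rw [Set.encard_univ, ENat.card_eq_coe_fintype_card]
  exact_mod_cast h

lemma encard_singleton_le (x : α) (h : 1 ≤ c) : ({x} : Set α).encard ≤ c := by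
  rw [Set.encard_singleton]; exact_mod_cast h

lemma encard_insert_le_of_le (x : α) (hs : s.encard ≤ a) (h : a + 1 ≤ c) :
    (insert x s).encard ≤ c := by
  refine (Set.encard_insert_le s x).trans ((add_le_add hs le_rfl).trans ?_)
  exact_mod_cast h

end card

namespace Reach

variable {S S' T T' U : Set (X → ℝ)} {W W' D D' : ℕ}

/-- Affine maps at either end of a network merge into the adjacent layers and are free. Only hidden
neurons are counted, so the set of outputs may even be infinite. -/
lemma post (h : Reach S W D T) (hU : U ⊆ affSpan T) : Reach S W D U := by
  cases h with
  | base h => exact base (hU.trans (affSpan_le h))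
  | step h hc hV hT => exact step h hc hV (hU.trans (affSpan_le hT))

lemma pre (h : Reach S W D T) (hS : S ⊆ affSpan S') : Reach S' W D T := by
  induction h with
  | base h => exact base (h.trans (affSpan_le hS))
  | step _ hc hV hT ih => exact step ih hc hV hT

lemma mono (h : Reach S W D T) (hW : W ≤ W') : Reach S W' D T := by
  induction h with
  | base h => exact base h
  | step _ hc hV hT ih => exact step ih (hc.trans (by exact_mod_cast hW)) hV hT

lemma comp (h : Reach S W D T) (h' : Reach T W D' U) : Reach S W (D + D') U := by
  induction h' with
  | base h' => exact h.post h'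
  | step _ hc hV hT ih => exact step ih hc hV hT

lemma layer (hc : U.encard ≤ W) (hU : ∀ g ∈ U, ∃ h ∈ affSpan S, g = relu h)
    (hT : T ⊆ affSpan U) : Reach S W 1 T :=
  step (base (T := S) subset_affSpan) hc hU hT

/-- A nonnegative family can be passed on through any number of layers. -/
lemma carry (hc : S.encard ≤ W) (h0 : ∀ g ∈ S, ∀ x, 0 ≤ g x) (D : ℕ) : Reach S W D S := by
  induction D with
  | zero => exact base subset_affSpan
  | succ D ih =>
    exact step ih hc (fun g hg => ⟨g, aff_mem hg, (relu_eq_self (h0 g hg)).symm⟩) subset_affSpan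

/-- Running two networks of equal depth side by side. -/
lemma par (h : Reach S W D T) (h' : Reach S' W' D T') :
    Reach (S ∪ S') (W + W') D (T ∪ T') := by
  induction D generalizing T T' with
  | zero =>
    cases h with | base h =>
    cases h' with | base h' =>
    exact base (Set.union_subset (h.trans (affSpan_mono Set.subset_union_left))
      (h'.trans (affSpan_mono Set.subset_union_right)))
  | succ D ih =>
    cases h with | step h hc hV hT =>
    cases h' with | step h' hc' hV' hT' =>
    refine step (ih h h') (encard_union_le_of_le hc hc' le_rfl) ?_
      (Set.union_subset (hT.trans (affSpan_mono Set.subset_union_left))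
        (hT'.trans (affSpan_mono Set.subset_union_right)))
    rintro g (hg | hg)
    · obtain ⟨k, hk, rfl⟩ := hV g hg
      exact ⟨k, affSpan_mono Set.subset_union_left hk, rfl⟩
    · obtain ⟨k, hk, rfl⟩ := hV' g hg
      exact ⟨k, affSpan_mono Set.subset_union_right hk, rfl⟩

/-- Two networks of equal depth on the same inputs. -/
lemma both (h : Reach S W D T) (h' : Reach S W' D T') : Reach S (W + W') D (T ∪ T') := by
  simpa using h.par h'

lemma iUnion {ι : Type*} (s : Finset ι) {T : ι → Set (X → ℝ)}
    (h : ∀ i ∈ s, Reach S W D (T i)) : Reach S (s.card * W) D (⋃ i ∈ s, T i) := by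
  classical
  induction s using Finset.induction_on with
  | empty =>
    simpa using (carry (S := (∅ : Set (X → ℝ))) (W := 0) (by simp) (by simp) D).pre
      (Set.empty_subset _)
  | insert i s hi ih =>
    have h1 := (h i (Finset.mem_insert_self _ _)).par
      (ih fun j hj => h j (Finset.mem_insert_of_mem hj))
    rw [Set.union_self] at h1
    rw [Finset.card_insert_of_notMem hi, Finset.set_biUnion_insert]
    exact h1.mono (by ring_nf; rfl)

/-- Nonnegative functions are carried along a network. -/
lemma frame (h : Reach S W D T) (F : Set (X → ℝ)) {c : ℕ} (hc : F.encard ≤ c)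
    (h0 : ∀ g ∈ F, ∀ x, 0 ≤ g x) (hW : W + c ≤ W') : Reach (S ∪ F) W' D (T ∪ F) :=
  (h.par (carry hc h0 D)).mono hW

/-- Nonnegative outputs can be delayed. -/
lemma pad (h : Reach S W D T) (hc : T.encard ≤ W) (h0 : ∀ g ∈ T, ∀ x, 0 ≤ g x) (hD : D ≤ D') :
    Reach S W D' T := by
  obtain ⟨k, rfl⟩ := Nat.exists_eq_add_of_le hD
  exact h.comp (carry hc h0 k)

/-- Precomposition with a change of the base type. -/
lemma comap {Y : Type*} (π : Y → X) (h : Reach S W D T) :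
    Reach ((fun g => g ∘ π) '' S) W D ((fun g => g ∘ π) '' T) := by
  induction h with
  | base h =>
    refine base ?_
    rintro _ ⟨g, hg, rfl⟩
    exact comp_mem_affSpan π (h hg)
  | @step D T U V _ hc hU hV ih =>
    refine step (U := (fun g => g ∘ π) '' U) ih ((Set.encard_image_le _ _).trans hc) ?_ ?_
    · rintro _ ⟨g, hg, rfl⟩
      obtain ⟨k, hk, rfl⟩ := hU g hg
      exact ⟨k ∘ π, comp_mem_affSpan π hk, rfl⟩
    · rintro _ ⟨g, hg, rfl⟩
      exact comp_mem_affSpan π (hV hg)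

/-- A network known on a domain `Y` over `X` is the restriction of a network on `X`. -/
lemma lift {Y : Type*} (π : Y → X) {T : Set (Y → ℝ)}
    (h : Reach ((fun g => g ∘ π) '' S) W D T) :
    ∃ T' : Set (X → ℝ), Reach S W D T' ∧ ∀ t ∈ T, ∃ t' ∈ T', t' ∘ π = t := by
  have key : ∀ {A : Set (X → ℝ)} {B : Set (Y → ℝ)}, (∀ t ∈ B, ∃ t' ∈ A, t' ∘ π = t) →
      ∀ f ∈ affSpan B, ∃ f' ∈ affSpan A, f' ∘ π = f := by
    intro A B hAB f hf
    have hB : B ⊆ (fun g => g ∘ π) '' A := fun t ht => by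
      obtain ⟨t', h1, h2⟩ := hAB t ht
      exact ⟨t', h1, h2⟩
    have hf' := affSpan_mono hB hf
    clear hf
    induction hf' using Submodule.span_induction with
    | mem g hg =>
      rcases hg with rfl | ⟨g, hg, rfl⟩
      · exact ⟨fun _ => 1, aff_const 1, rfl⟩
      · exact ⟨g, aff_mem hg, rfl⟩
    | zero => exact ⟨0, zero_mem _, rfl⟩
    | add g h _ _ hg hh =>
      obtain ⟨g', hg', rfl⟩ := hg
      obtain ⟨h', hh', rfl⟩ := hh
      exact ⟨_, add_mem hg' hh', rfl⟩
    | smul c g _ hg =>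
      obtain ⟨g', hg', rfl⟩ := hg
      exact ⟨_, Submodule.smul_mem _ c hg', rfl⟩
  induction h with
  | base h =>
    refine ⟨affSpan S, base le_rfl, fun t ht => ?_⟩
    refine key (B := (fun g => g ∘ π) '' S) ?_ t (h ht)
    rintro _ ⟨g, hg, rfl⟩
    exact ⟨g, hg, rfl⟩
  | @step D T U V _ hc hU hV ih =>
    obtain ⟨T', hT', hTT⟩ := ih
    have hk : ∀ g ∈ U, ∃ k ∈ affSpan T', relu k ∘ π = g := by
      intro g hg
      obtain ⟨k, hk, rfl⟩ := hU g hg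
      obtain ⟨k', hk', rfl⟩ := key hTT k hk
      exact ⟨k', hk', rfl⟩
    -- One lifted preactivation per neuron: the new layer is an image of `U`, so the width bound
    -- survives.
    choose! k hk1 hk2 using hk
    refine ⟨affSpan ((fun g => relu (k g)) '' U), step (U := (fun g => relu (k g)) '' U) hT'
      ((Set.encard_image_le _ _).trans hc) ?_ le_rfl, ?_⟩
    · rintro _ ⟨g, hg, rfl⟩
      exact ⟨k g, hk1 g hg, rfl⟩
    · intro t ht
      exact key (A := (fun g => relu (k g)) '' U) (B := U)
        (fun g hg => ⟨_, ⟨g, hg, rfl⟩, hk2 g hg⟩) t (hV ht)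

end Reach

end ReLUCalculus

/-! ### Digit extraction, exact multiplication, table lookup, bit extraction -/

namespace ReLUCalculus

universe u

variable {X : Type u}

/-- All real functions of a natural-number valued quantity. -/
def funsOf (a : X → ℕ) : Set (X → ℝ) := Set.range fun φ : ℕ → ℝ => φ ∘ a

lemma mem_funsOf (a : X → ℕ) (φ : ℕ → ℝ) : (fun x => φ (a x)) ∈ funsOf a := ⟨φ, rfl⟩

lemma cast_mem_funsOf (a : X → ℕ) : (fun x => (a x : ℝ)) ∈ funsOf a :=
  mem_funsOf a fun n => (n : ℝ)

/-- A quantity with `A` values is known in unary once its `A` indicators are available: every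
function of it, in particular every table indexed by it, is then a linear combination of them. -/
lemma funsOf_subset_of_indicator {a : X → ℕ} {A : ℕ} (ha : ∀ x, a x < A) {S : Set (X → ℝ)}
    (h : ∀ i < A, (fun x => if a x = i then (1 : ℝ) else 0) ∈ affSpan S) :
    funsOf a ⊆ affSpan S := by
  rintro _ ⟨φ, rfl⟩
  have : φ ∘ a = fun x => ∑ i ∈ Finset.range A, φ i * (if a x = i then (1 : ℝ) else 0) := by
    ext x
    simp [ha x]
  simp only [this]
  exact aff_sum _ fun i hi => aff_mul _ (h i (Finset.mem_range.1 hi))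

/-- Indicators of single values are differences of consecutive threshold gates; the gates at `0` and
beyond `A` are constant. -/
lemma funsOf_subset_of_gate {a : X → ℕ} {A : ℕ} (ha : ∀ x, a x < A) {S : Set (X → ℝ)}
    (h : ∀ i, 1 ≤ i → i < A → (fun x => if i ≤ a x then (1 : ℝ) else 0) ∈ affSpan S) :
    funsOf a ⊆ affSpan S := by
  have h' : ∀ i, (fun x => if i ≤ a x then (1 : ℝ) else 0) ∈ affSpan S := by
    intro i
    rcases Nat.eq_zero_or_pos i with rfl | hi
    · simpa using aff_const (S := S) 1
    · by_cases hA : i < A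
      · exact h i hi hA
      · have : (fun x => if i ≤ a x then (1 : ℝ) else 0) = fun _ => 0 := by
          ext x
          have := ha x
          rw [if_neg (by omega)]
        rw [this]
        exact aff_const 0
  refine funsOf_subset_of_indicator ha fun i _ => ?_
  have : (fun x => if a x = i then (1 : ℝ) else 0) = fun x =>
      (if i ≤ a x then (1 : ℝ) else 0) - (if i + 1 ≤ a x then (1 : ℝ) else 0) := by
    ext x
    rcases lt_trichotomy (a x) i with h | h | h
    · rw [if_neg (by omega), if_neg (by omega), if_neg (by omega)]; simp
    · rw [if_pos (by omega), if_pos (by omega), if_neg (by omega)]; simp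
    · rw [if_neg (by omega), if_pos (by omega), if_pos (by omega)]; simp
  rw [this]
  exact aff_sub (h' _) (h' _)

lemma reach_carry_funsOf {a : X → ℕ} {A : ℕ} (ha : ∀ x, a x < A) (D : ℕ) :
    Reach (funsOf a) A D (funsOf a) := by
  set S₀ : Set (X → ℝ) := Set.range fun (i : Fin A) x => if a x = i then (1 : ℝ) else 0
  have h1 : funsOf a ⊆ affSpan S₀ :=
    funsOf_subset_of_indicator ha fun i hi => aff_mem ⟨⟨i, hi⟩, rfl⟩
  have h2 : S₀ ⊆ funsOf a := by
    rintro _ ⟨i, rfl⟩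
    exact mem_funsOf a fun n => if n = i then 1 else 0
  refine ((Reach.carry (S := S₀) (encard_range_le _ (by simp)) ?_ D).pre
    (h2.trans subset_affSpan)).post h1
  rintro _ ⟨i, rfl⟩ x
  dsimp only
  split_ifs <;> norm_num

/-- A continuous ramp of slope `δ⁻¹` rises on `[i - δ, i]`; since `v` never enters the interior of
such an interval, it acts as an exact step. -/
lemma gate_eq {v δ : ℝ} {a i : ℕ} (hδ : 0 < δ) (h1 : (a : ℝ) ≤ v) (h2 : v ≤ a + 1 - δ) :
    δ⁻¹ * (max 0 (v - i + δ) - max 0 (v - i)) = if i ≤ a then 1 else 0 := by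
  split_ifs with h
  · have : (i : ℝ) ≤ a := by exact_mod_cast h
    rw [max_eq_right (by linarith), max_eq_right (by linarith)]
    field_simp
    ring
  · have : (a : ℝ) + 1 ≤ i := by exact_mod_cast (not_le.1 h)
    rw [max_eq_left (by linarith), max_eq_left (by linarith)]
    simp

/-- Extraction of the leading base `R` digit. -/
lemma reach_digit {u : X → ℝ} {a : X → ℕ} {R : ℕ} {δ : ℝ} (hδ : 0 < δ) (hu : ∀ x, 0 ≤ u x)
    (ha : ∀ x, a x < R) (h1 : ∀ x, (a x : ℝ) ≤ R * u x) (h2 : ∀ x, R * u x ≤ a x + 1 - δ) :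
    Reach {u} (2 * R + 1) 1 ({u} ∪ funsOf a) := by
  set G₁ : Fin R → X → ℝ := fun i => relu fun x => R * u x - (i : ℕ) + δ
  set G₂ : Fin R → X → ℝ := fun i => relu fun x => R * u x - (i : ℕ)
  have hu' : u ∈ affSpan ({u} : Set (X → ℝ)) := aff_mem rfl
  refine Reach.layer (U := {u} ∪ (Set.range G₁ ∪ Set.range G₂))
    (encard_union_le_of_le (encard_singleton_le _ le_rfl)
      (encard_union_le_of_le (encard_range_le _ (by simp; rfl)) (encard_range_le _ (by simp; rfl))
        le_rfl) (by omega)) ?_ (Set.union_subset ?_ ?_)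
  · rintro g (rfl | ⟨i, rfl⟩ | ⟨i, rfl⟩)
    · exact ⟨g, hu', (relu_eq_self hu).symm⟩
    · exact ⟨_, aff_add (aff_sub (aff_mul _ hu') (aff_const _)) (aff_const _), rfl⟩
    · exact ⟨_, aff_sub (aff_mul _ hu') (aff_const _), rfl⟩
  · exact Set.subset_union_left.trans subset_affSpan
  · refine funsOf_subset_of_gate ha fun i _ hi => ?_
    have : (fun x => if i ≤ a x then (1 : ℝ) else 0) =
        fun x => δ⁻¹ * (G₁ ⟨i, hi⟩ x - G₂ ⟨i, hi⟩ x) := by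
      ext x
      exact (gate_eq hδ (h1 x) (h2 x)).symm
    rw [this]
    exact aff_mul _ (aff_sub (aff_mem (Or.inr (Or.inl ⟨_, rfl⟩)))
      (aff_mem (Or.inr (Or.inr ⟨_, rfl⟩))))

/-- Splitting off the leading digit keeps the safety gap alive: it is `δ / T` for the quotient and
again `δ` for the remainder. A small gap only makes weights large, which costs nothing. -/
lemma digit_bounds {T k : ℕ} (hT : 0 < T) {v δ : ℝ} (h1 : (k : ℝ) ≤ T * v)
    (h2 : T * v ≤ k + 1 - δ) :
    ((k / T : ℕ) : ℝ) ≤ v ∧ v ≤ (k / T : ℕ) + 1 - δ / T ∧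
      ((k % T : ℕ) : ℝ) ≤ T * (v - (k / T : ℕ)) ∧
      T * (v - (k / T : ℕ)) ≤ (k % T : ℕ) + 1 - δ := by
  have hk : (k : ℝ) = T * (k / T : ℕ) + (k % T : ℕ) := by exact_mod_cast (Nat.div_add_mod k T).symm
  have hm : ((k % T : ℕ) : ℝ) + 1 ≤ T := by exact_mod_cast Nat.mod_lt k hT
  have hm0 : (0 : ℝ) ≤ (k % T : ℕ) := Nat.cast_nonneg _
  have hT' : (0 : ℝ) < T := by exact_mod_cast hT
  refine ⟨?_, ?_, by linarith, by linarith⟩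
  · refine le_of_mul_le_mul_left ?_ hT'
    linarith
  · refine le_of_mul_le_mul_left ?_ hT'
    have : (T : ℝ) * ((k / T : ℕ) + 1 - δ / T) = T * (k / T : ℕ) + T - δ := by
      field_simp
    rw [this]
    linarith

/-- Integer and fractional part of `R ^ l * u`, digit by digit. -/
lemma reach_quantize {R : ℕ} (hR : 0 < R) (l : ℕ) : ∀ {u acc : X → ℝ} {k : X → ℕ} {δ : ℝ},
    0 < δ → (∀ x, 0 ≤ u x) → (∀ x, 0 ≤ acc x) → (∀ x, k x < R ^ l) →
    (∀ x, (k x : ℝ) ≤ R ^ l * u x) → (∀ x, R ^ l * u x ≤ k x + 1 - δ) →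
    Reach {u, acc} (2 * R + 2) l
      {fun x => R ^ l * u x - k x, fun x => R ^ l * acc x + k x} := by
  induction l with
  | zero =>
    intro u acc k δ hδ hu hacc hk h1 h2
    have hk0 : ∀ x, k x = 0 := fun x => by simpa using hk x
    simp only [hk0, pow_zero, one_mul, Nat.cast_zero, sub_zero, add_zero]
    exact Reach.base subset_affSpan
  | succ l ih =>
    intro u acc k δ hδ hu hacc hk h1 h2
    have hT : 0 < R ^ l := pow_pos hR l
    have hb := fun x => digit_bounds (k := k x) hT (v := R * u x) (δ := δ)
      (by push_cast; rw [← mul_assoc, ← pow_succ]; exact h1 x)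
      (by push_cast; rw [← mul_assoc, ← pow_succ]; exact h2 x)
    have ha : ∀ x, k x / R ^ l < R := fun x => by
      rw [Nat.div_lt_iff_lt_mul hT, ← pow_succ']; exact hk x
    have hd := reach_digit (u := u) (a := fun x => k x / R ^ l) (δ := δ / (R ^ l : ℕ))
      (by positivity) hu ha (fun x => (hb x).1) (fun x => (hb x).2.1)
    have hd' := hd.frame {acc} (encard_singleton_le _ le_rfl)
      (by rintro _ rfl; exact hacc) (le_refl (2 * R + 1 + 1))
    have hmid : Reach {u, acc} (2 * R + 2) 1 {fun x => R * u x - (k x / R ^ l : ℕ),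
        fun x => R * acc x + (k x / R ^ l : ℕ)} := by
      refine hd'.post ?_
      have hdig : (fun x => ((k x / R ^ l : ℕ) : ℝ)) ∈
          affSpan ({u} ∪ funsOf (fun x => k x / R ^ l) ∪ {acc}) :=
        aff_mem (Or.inl (Or.inr (cast_mem_funsOf fun x => k x / R ^ l)))
      rintro _ (rfl | rfl)
      · exact aff_sub (aff_mul _ (aff_mem (Or.inl (Or.inl rfl)))) hdig
      · exact aff_add (aff_mul _ (aff_mem (Or.inr rfl))) hdig
    have hrest := ih (u := fun x => R * u x - (k x / R ^ l : ℕ))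
      (acc := fun x => R * acc x + (k x / R ^ l : ℕ)) (k := fun x => k x % R ^ l) hδ
      (fun x => sub_nonneg.2 (hb x).1) (fun x => by have := hacc x; positivity)
      (fun x => Nat.mod_lt _ hT)
      (fun x => by simpa using (hb x).2.2.1) (fun x => by simpa using (hb x).2.2.2)
    have := hmid.comp hrest
    rw [add_comm 1 l] at this
    have hkk : ∀ x, (k x : ℝ) = R ^ l * (k x / R ^ l : ℕ) + (k x % R ^ l : ℕ) := fun x => by
      exact_mod_cast (Nat.div_add_mod (k x) (R ^ l)).symm
    convert this using 2
    · ext x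
      rw [hkk x]; ring
    · congr 1
      ext x
      rw [hkk x]; ring

lemma sum_gate {R a : ℕ} (ha : a < R) :
    ∑ i : Fin R, (if (i : ℕ) + 1 ≤ a then (1 : ℝ) else 0) = a := by
  rw [Fin.sum_univ_eq_sum_range (fun i => if i + 1 ≤ a then (1 : ℝ) else 0), ← Finset.sum_filter]
  have : (Finset.range R).filter (fun i => i + 1 ≤ a) = Finset.range a := by
    ext i; simp; omega
  rw [this]
  simp

/-- Exact multiplication of a number in `[0, 1]` by a number with `L` digits in base `R`. -/
lemma reach_mul {R : ℕ} (hR : 0 < R) (L : ℕ) : ∀ {u z acc : X → ℝ} {k : X → ℕ} {δ : ℝ},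
    0 < δ → (∀ x, 0 ≤ u x) → (∀ x, 0 ≤ z x) → (∀ x, z x ≤ 1) → (∀ x, 0 ≤ acc x) →
    (∀ x, k x < R ^ L) → (∀ x, (k x : ℝ) ≤ R ^ L * u x) → (∀ x, R ^ L * u x ≤ k x + 1 - δ) →
    Reach {u, z, acc} (2 * R + 3) (2 * L) {fun x => acc x + z x * (k x / R ^ L)} := by
  induction L with
  | zero =>
    intro u z acc k δ hδ hu hz hz1 hacc hk h1 h2
    have hk0 : ∀ x, k x = 0 := fun x => by simpa using hk x
    refine Reach.base ?_
    rintro _ rfl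
    simpa [hk0] using aff_mem (S := {u, z, acc}) (f := acc) (by simp)
  | succ L ih =>
    intro u z acc k δ hδ hu hz hz1 hacc hk h1 h2
    have hT : 0 < R ^ L := pow_pos hR L
    have hb := fun x => digit_bounds (k := k x) hT (v := R * u x) (δ := δ)
      (by push_cast; rw [← mul_assoc, ← pow_succ]; exact h1 x)
      (by push_cast; rw [← mul_assoc, ← pow_succ]; exact h2 x)
    set a : X → ℕ := fun x => k x / R ^ L with ha_def
    have ha : ∀ x, a x < R := fun x => by
      rw [ha_def, Nat.div_lt_iff_lt_mul hT, ← pow_succ']; exact hk x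
    have hd := (reach_digit (u := u) (a := a) (δ := δ / (R ^ L : ℕ))
      (by positivity) hu ha (fun x => (hb x).1) (fun x => (hb x).2.1)).frame {z, acc}
      (c := 2) (encard_insert_le_of_le _ (encard_singleton_le _ le_rfl) le_rfl)
      (by rintro _ (rfl | rfl) <;> assumption) (le_refl (2 * R + 1 + 2))
    set S₁ : Set (X → ℝ) := {u} ∪ funsOf a ∪ {z, acc}
    set u' : X → ℝ := fun x => R * u x - a x with hu'
    have hu'S : u' ∈ affSpan S₁ := aff_sub (aff_mul _ (aff_mem (by simp [S₁])))
      (aff_mem (Or.inl (Or.inr (cast_mem_funsOf a))))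
    -- As `0 ≤ z ≤ 1`, each gate equals `z` or `0` exactly, and exactly `a x` of them are open, so
    -- their sum is `z * a`.
    set G : Fin R → X → ℝ := fun i => relu fun x => z x + (if (i : ℕ) + 1 ≤ a x then 1 else 0) - 1
    have hG : ∀ i x, G i x = z x * (if (i : ℕ) + 1 ≤ a x then 1 else 0) := by
      intro i x
      have h0 := hz x
      have h1 := hz1 x
      simp only [G, relu]
      split_ifs
      · simp [h0]
      · simp [h1]
    have hmul : Reach S₁ (2 * R + 3) 1
        {u', fun x => (R : ℝ)⁻¹ * z x, fun x => acc x + (R : ℝ)⁻¹ * (∑ i, G i x)} := by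
      refine Reach.layer (U := Set.range G ∪ {u', z, acc})
        (encard_union_le_of_le (b := 3) (encard_range_le _ (by simp; rfl))
          (encard_insert_le_of_le _ (encard_insert_le_of_le _ (encard_singleton_le _ le_rfl) le_rfl)
            le_rfl) (by omega)) ?_ ?_
      · rintro g (⟨i, rfl⟩ | rfl | rfl | rfl)
        · exact ⟨_, aff_sub (aff_add (aff_mem (by simp [S₁])) (aff_mem (Or.inl (Or.inr
            (mem_funsOf a fun n => if (i : ℕ) + 1 ≤ n then 1 else 0))))) (aff_const _), rfl⟩
        · exact ⟨_, hu'S, (relu_eq_self fun x => sub_nonneg.2 (hb x).1).symm⟩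
        · exact ⟨_, aff_mem (by simp [S₁]), (relu_eq_self hz).symm⟩
        · exact ⟨_, aff_mem (by simp [S₁]), (relu_eq_self hacc).symm⟩
      · rintro _ (rfl | rfl | rfl)
        · exact aff_mem (by simp)
        · exact aff_mul _ (aff_mem (by simp))
        · exact aff_add (aff_mem (by simp)) (aff_mul _ (aff_sum _ fun i _ => aff_mem (by simp)))
    have hR' : (0 : ℝ) < R := by exact_mod_cast hR
    have hR1 : (1 : ℝ) ≤ R := by exact_mod_cast hR
    have hsum : ∀ x, ∑ i, G i x = z x * a x := fun x => by
      simp only [hG, ← Finset.mul_sum, sum_gate (ha x)]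
    simp only [hsum] at hmul
    -- Dividing `z` by `R` at every digit carries the place value of the digits still to come.
    have hrest := ih (u := u') (z := fun x => (R : ℝ)⁻¹ * z x)
      (acc := fun x => acc x + (R : ℝ)⁻¹ * (z x * a x)) (k := fun x => k x % R ^ L) hδ
      (fun x => sub_nonneg.2 (hb x).1) (fun x => by have := hz x; positivity)
      (fun x => by
        rw [inv_mul_le_iff₀ hR']
        linarith [hz1 x])
      (fun x => by have := hz x; have := hacc x; positivity)
      (fun x => Nat.mod_lt _ hT)
      (fun x => by simpa using (hb x).2.2.1) (fun x => by simpa using (hb x).2.2.2)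
    have := (hd.comp hmul).comp hrest
    rw [show 1 + 1 + 2 * L = 2 * (L + 1) by ring] at this
    have hkk : ∀ x, (k x : ℝ) = R ^ L * (a x : ℕ) + (k x % R ^ L : ℕ) := fun x => by
      exact_mod_cast (Nat.div_add_mod (k x) (R ^ L)).symm
    have hS : ({u} ∪ {z, acc} : Set (X → ℝ)) = {u, z, acc} := by
      rw [Set.singleton_union]
    rw [hS] at this
    convert this using 2
    ext x
    rw [hkk x]
    field_simp
    ring

/-- The indicator of a value of a natural-number valued quantity. -/
lemma reach_indicator (v : X → ℕ) (t : ℕ) :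
    Reach {fun x => (v x : ℝ)} 3 1 {fun x => if v x = t then (1 : ℝ) else 0} := by
  set G : ℝ → X → ℝ := fun c => relu fun x => (v x : ℝ) - c
  refine Reach.layer (U := {G (t - 1), G t, G (t + 1)})
    (encard_insert_le_of_le _ (encard_insert_le_of_le _ (encard_singleton_le _ le_rfl) le_rfl)
      le_rfl) ?_ ?_
  · have : ∀ c, ∃ h ∈ affSpan {fun x => (v x : ℝ)}, G c = relu h := fun c =>
      ⟨_, aff_sub (aff_mem rfl) (aff_const c), rfl⟩
    rintro _ (rfl | rfl | rfl) <;> exact this _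
  · rintro _ rfl
    have : (fun x => if v x = t then (1 : ℝ) else 0) =
        fun x => G (t - 1) x - 2 * G t x + G (t + 1) x := by
      ext x
      simp only [G, relu]
      rcases lt_trichotomy (v x) t with h | h | h
      · have : (v x : ℝ) + 1 ≤ t := by exact_mod_cast h
        rw [if_neg h.ne, max_eq_left (by linarith), max_eq_left (by linarith),
          max_eq_left (by linarith)]
        simp
      · rw [if_pos h, h, max_eq_right (by linarith), max_eq_left (by linarith),
          max_eq_left (by linarith)]
        ring
      · have : (t : ℝ) + 1 ≤ v x := by exact_mod_cast h
        rw [if_neg h.ne', max_eq_right (by linarith), max_eq_right (by linarith),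
          max_eq_right (by linarith)]
        ring
    rw [this]
    exact aff_add (aff_sub (aff_mem (by simp)) (aff_mul _ (aff_mem (by simp)))) (aff_mem (by simp))

/-- A conditional read from a two-dimensional table. -/
lemma reach_read {A : ℕ} {a b : X → ℕ} {q : X → Prop} [DecidablePred q] {Y : ℕ → ℕ → ℝ}
    (hb : ∀ x, b x < A) (hY0 : ∀ i j, 0 ≤ Y i j) (hY1 : ∀ i j, Y i j ≤ 1) :
    Reach (funsOf a ∪ funsOf b ∪ {fun x => if q x then (1 : ℝ) else 0}) A 1
      {fun x => if q x then Y (a x) (b x) else 0} := by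
  -- Because `0 ≤ Y ≤ 1`, the threshold `2` lets `Y (a x) i` pass exactly when both `b x = i` and `q
  -- x` hold. The function `Y (a x) i` of `a` needs no neuron of its own.
  set G : Fin A → X → ℝ := fun i => relu fun x =>
    Y (a x) i + (if b x = i then (1 : ℝ) else 0) + (if q x then (1 : ℝ) else 0) - 2
  refine Reach.layer (U := Set.range G) (encard_range_le _ (by simp)) ?_ ?_
  · rintro _ ⟨i, rfl⟩
    exact ⟨_, aff_sub (aff_add (aff_add
      (aff_mem (Or.inl (Or.inl (mem_funsOf a fun n => Y n i))))
      (aff_mem (Or.inl (Or.inr (mem_funsOf b fun n => if n = i then 1 else 0)))))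
      (aff_mem (Or.inr rfl))) (aff_const _), rfl⟩
  · rintro _ rfl
    have : (fun x => if q x then Y (a x) (b x) else 0) = fun x => ∑ i, G i x := by
      ext x
      rw [Finset.sum_eq_single ⟨b x, hb x⟩]
      · have := hY0 (a x) (b x)
        have := hY1 (a x) (b x)
        simp only [G, relu, if_true]
        split_ifs
        · rw [max_eq_right (by linarith)]; ring
        · rw [max_eq_left (by linarith)]
      · intro i _ hi
        have := hY1 (a x) i
        have hne : ¬ b x = i := fun h => hi (by ext; exact h.symm)
        simp only [G, relu, if_neg hne]
        split_ifs
        · rw [max_eq_left (by linarith)]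
        · rw [max_eq_left (by linarith)]
      · simp
    rw [this]
    exact aff_sum _ fun i _ => aff_mem ⟨i, rfl⟩

/-- Table lookup: two coordinates are handled by width, the third one by depth. -/
lemma reach_lookup {A : ℕ} {a b v : X → ℕ} {Y : ℕ → ℕ → ℕ → ℝ} (ha : ∀ x, a x < A)
    (hb : ∀ x, b x < A) (hY0 : ∀ i j k, 0 ≤ Y i j k) (hY1 : ∀ i j k, Y i j k ≤ 1) (B : ℕ) :
    Reach (funsOf a ∪ funsOf b ∪ {fun x => (v x : ℝ)}) (3 * A + 5) (2 * B)
      (funsOf a ∪ funsOf b ∪ {fun x => (v x : ℝ)} ∪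
        {fun x => if v x < B then Y (v x) (a x) (b x) else 0}) := by
  set S : Set (X → ℝ) := funsOf a ∪ funsOf b ∪ {fun x => (v x : ℝ)} with hS
  have hcarry : ∀ D, Reach S (2 * A + 1) D S := fun D =>
    (((reach_carry_funsOf ha D).par (reach_carry_funsOf hb D)).par
      (Reach.carry (S := {fun x => (v x : ℝ)}) (encard_singleton_le _ le_rfl)
        (by rintro _ rfl x; positivity) D)).mono (by omega)
  induction B with
  | zero =>
    refine Reach.base (Set.union_subset subset_affSpan ?_)
    rintro _ rfl
    simpa using aff_const 0
  | succ B ih =>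
    set acc : X → ℝ := fun x => if v x < B then Y (v x) (a x) (b x) else 0 with hacc
    have hacc0 : ∀ x, 0 ≤ acc x := fun x => by
      simp only [hacc]; split_ifs
      · exact hY0 _ _ _
      · exact le_rfl
    have hcarry' : Reach (S ∪ {acc}) (2 * A + 2) 1 (S ∪ {acc}) :=
      (hcarry 1).frame {acc} (encard_singleton_le _ le_rfl) (by rintro _ rfl; exact hacc0) le_rfl
    -- Two layers per value of `v`: one tests `v = B`, the other reads row `B` if the test succeeds.
    -- At most one row contributes to the accumulator.
    have h1 : Reach (S ∪ {acc}) (3 * A + 5) 1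
        (S ∪ {acc} ∪ {fun x => if v x = B then (1 : ℝ) else 0}) :=
      (hcarry'.both ((reach_indicator v B).pre (S' := S ∪ {acc}) (by
        rintro _ rfl; exact aff_mem (by simp [hS])))).mono (by omega)
    have h2 : Reach (S ∪ {acc} ∪ {fun x => if v x = B then (1 : ℝ) else 0}) (3 * A + 5) 1
        (S ∪ {acc} ∪ {fun x => if v x = B then Y B (a x) (b x) else 0}) := by
      refine ((hcarry'.pre (S' := S ∪ {acc} ∪ {fun x => if v x = B then (1 : ℝ) else 0})
        (Set.subset_union_left.trans subset_affSpan)).both ((reach_read (A := A) (a := a) (b := b)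
        (q := fun x => v x = B) (Y := Y B) hb (hY0 B) (hY1 B)).pre ?_)).mono (by omega)
      refine Set.Subset.trans ?_ subset_affSpan
      rintro g ((hg | hg) | hg)
      · exact Or.inl (Or.inl (Or.inl (Or.inl hg)))
      · exact Or.inl (Or.inl (Or.inl (Or.inr hg)))
      · exact Or.inr hg
    refine ((ih.comp h1).comp h2).post (Set.union_subset ?_ ?_)
    · exact Set.Subset.trans (fun g hg => Or.inl (Or.inl hg)) subset_affSpan
    · rintro _ rfl
      have : (fun x => if v x < B + 1 then Y (v x) (a x) (b x) else 0) =
          fun x => acc x + (if v x = B then Y B (a x) (b x) else 0) := by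
        ext x
        simp only [hacc]
        rcases lt_trichotomy (v x) B with h | h | h
        · rw [if_pos (by omega), if_pos h, if_neg h.ne, add_zero]
        · rw [if_pos (by omega), if_neg (by omega), if_pos h, h, zero_add]
        · rw [if_neg (by omega), if_neg (by omega), if_neg (by omega), add_zero]
      rw [this]
      exact aff_add (aff_mem (by simp)) (aff_mem (by simp))

lemma sum_bits_nonneg (T : ℕ) (b : ℕ → ℕ) : 0 ≤ ∑ t ∈ Finset.range T, (b t : ℝ) / 2 ^ (t + 1) :=
  Finset.sum_nonneg fun _ _ => by positivity

/-- The deficit `1 / 2 ^ T` below `1` is the safety gap that digit extraction needs. -/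
lemma sum_bits_le (T : ℕ) : ∀ {b : ℕ → ℕ}, (∀ t, b t ≤ 1) →
    ∑ t ∈ Finset.range T, (b t : ℝ) / 2 ^ (t + 1) ≤ 1 - 1 / 2 ^ T := by
  induction T with
  | zero => intro b _; simp
  | succ T ih =>
    intro b hb
    rw [Finset.sum_range_succ]
    have h1 := ih hb
    have h2 : (b T : ℝ) ≤ 1 := by exact_mod_cast hb T
    have h3 : (b T : ℝ) / 2 ^ (T + 1) ≤ 1 / 2 ^ (T + 1) := by gcongr
    have h4 : (1 : ℝ) / 2 ^ T = 2 * (1 / 2 ^ (T + 1)) := by rw [pow_succ]; field_simp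
    linarith

/-- Sequential extraction of binary digits; the digits whose block number is `w` are multiplied
by `z`, weighted, and added up. -/
lemma reach_bits (T : ℕ) : ∀ {b : ℕ → X → ℕ} {c : ℕ → ℝ} {blk : ℕ → ℕ} {w : X → ℕ}
    {z acc : X → ℝ}, (∀ t x, b t x ≤ 1) → (∀ t, 0 ≤ c t) → (∀ x, 0 ≤ z x) → (∀ x, z x ≤ 1) →
    (∀ x, 0 ≤ acc x) →
    Reach {fun x => ∑ t ∈ Finset.range T, (b t x : ℝ) / 2 ^ (t + 1), fun x => (w x : ℝ), z, acc}
      11 (2 * T)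
      {fun x => acc x + ∑ t ∈ Finset.range T,
        if w x = blk t then c t * (b t x * z x) else 0} := by
  induction T with
  | zero =>
    intro b c blk w z acc _ _ _ _ _
    refine Reach.base ?_
    rintro _ rfl
    simpa using aff_mem (by simp)
  | succ T ih =>
    intro b c blk w z acc hb hc hz hz1 hacc
    set u : X → ℝ := fun x => ∑ t ∈ Finset.range (T + 1), (b t x : ℝ) / 2 ^ (t + 1) with hu
    set u' : X → ℝ := fun x => ∑ t ∈ Finset.range T, (b (t + 1) x : ℝ) / 2 ^ (t + 1) with hu'
    set wr : X → ℝ := fun x => (w x : ℝ)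
    have huu : ∀ x, 2 * u x = b 0 x + u' x := by
      intro x
      simp only [hu, hu', Finset.sum_range_succ']
      rw [mul_add, Finset.mul_sum, add_comm]
      congr 1
      · simp; ring
      · refine Finset.sum_congr rfl fun t _ => ?_
        rw [pow_succ _ (t + 1)]; field_simp
    have hu0 : ∀ x, 0 ≤ u x := fun x => sum_bits_nonneg _ fun t => b t x
    have hu'0 : ∀ x, 0 ≤ u' x := fun x => sum_bits_nonneg _ fun t => b (t + 1) x
    have hu'1 : ∀ x, u' x ≤ 1 - 1 / 2 ^ T := fun x =>
      sum_bits_le T (b := fun t => b (t + 1) x) fun t => hb _ x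
    have hd := reach_digit (u := u) (a := b 0) (R := 2) (δ := 1 / 2 ^ T) (by positivity) hu0
      (fun x => Nat.lt_succ_of_le (hb 0 x)) (fun x => by push_cast; linarith [huu x, hu'0 x])
      (fun x => by push_cast; linarith [huu x, hu'1 x])
    have hi := reach_indicator w (blk 0)
    set S : Set (X → ℝ) := {u, wr, z, acc}
    set ind : X → ℝ := fun x => if w x = blk 0 then (1 : ℝ) else 0
    have h1 : Reach S 11 1 ({u} ∪ funsOf (b 0) ∪ {ind} ∪ {wr, z, acc}) := by
      refine (((hd.pre (S' := S) ?_).both (hi.pre (S' := S) ?_)).both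
        ((Reach.carry (S := {wr, z, acc}) (W := 3) ?_ ?_ 1).pre (S' := S) ?_)).mono (by norm_num)
      · rintro _ rfl; exact aff_mem (by simp [S])
      · rintro _ rfl; exact aff_mem (by simp [S, wr])
      · exact encard_insert_le_of_le _ (encard_insert_le_of_le _ (encard_singleton_le _ le_rfl)
          le_rfl) le_rfl
      · rintro _ (rfl | rfl | rfl)
        · intro x; positivity
        · exact hz
        · exact hacc
      · exact (Set.subset_insert _ _).trans subset_affSpan
    -- Two factors are `0` or `1` and `z` lies in `[0, 1]`, so this single neuron is the product of
    -- the three.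
    set G : X → ℝ := relu fun x => (b 0 x : ℝ) + ind x + z x - 2 with hG_def
    have hG : ∀ x, G x = if w x = blk 0 then b 0 x * z x else 0 := by
      intro x
      have h0 := hz x
      have h1 := hz1 x
      have h2 : b 0 x = 0 ∨ b 0 x = 1 := by have := hb 0 x; omega
      simp only [G, ind, relu]
      rcases h2 with h2 | h2 <;> rw [h2] <;> split_ifs
      · rw [max_eq_left (by push_cast; linarith)]; simp
      · rw [max_eq_left (by push_cast; linarith)]
      · rw [max_eq_right (by push_cast; linarith)]; push_cast; ring
      · rw [max_eq_left (by push_cast; linarith)]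
    have hG0 : ∀ x, 0 ≤ G x := fun x => le_max_left _ _
    have h2 : Reach ({u} ∪ funsOf (b 0) ∪ {ind} ∪ {wr, z, acc}) 11 1
        {u', wr, z, fun x => acc x + c 0 * G x} := by
      refine Reach.layer (U := {G, u', wr, z, acc})
        (encard_insert_le_of_le (a := 4) _ (encard_insert_le_of_le _ (encard_insert_le_of_le _
          (encard_insert_le_of_le _ (encard_singleton_le _ le_rfl) le_rfl) le_rfl) le_rfl)
          (by norm_num)) ?_ ?_
      · have hb0 : (fun x => (b 0 x : ℝ)) ∈
            affSpan ({u} ∪ funsOf (b 0) ∪ {ind} ∪ {wr, z, acc}) :=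
          aff_mem (Or.inl (Or.inl (Or.inr (cast_mem_funsOf _))))
        rintro _ (rfl | rfl | rfl | rfl | rfl)
        · exact ⟨_, aff_sub (aff_add (aff_add hb0 (aff_mem (by simp))) (aff_mem (by simp)))
            (aff_const _), rfl⟩
        · have : u' = fun x => 2 * u x - b 0 x := by
            ext x; linarith [huu x]
          refine ⟨u', ?_, (relu_eq_self hu'0).symm⟩
          rw [this]
          exact aff_sub (aff_mul _ (aff_mem (by simp))) hb0
        · exact ⟨_, aff_mem (by simp), (relu_eq_self fun x => by positivity).symm⟩
        · exact ⟨_, aff_mem (by simp), (relu_eq_self hz).symm⟩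
        · exact ⟨_, aff_mem (by simp), (relu_eq_self hacc).symm⟩
      · rintro _ (rfl | rfl | rfl | rfl)
        · exact aff_mem (by simp)
        · exact aff_mem (by simp)
        · exact aff_mem (by simp)
        · exact aff_add (aff_mem (by simp)) (aff_mul _ (aff_mem (by simp)))
    have h3 := ih (b := fun t => b (t + 1)) (c := fun t => c (t + 1)) (blk := fun t => blk (t + 1))
      (w := w) (z := z) (acc := fun x => acc x + c 0 * G x) (fun t => hb _) (fun t => hc _) hz hz1
      (fun x => add_nonneg (hacc x) (mul_nonneg (hc 0) (hG0 x)))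
    have := (h1.comp h2).comp h3
    rw [show 1 + 1 + 2 * T = 2 * (T + 1) by ring] at this
    convert this using 2
    ext x
    rw [Finset.sum_range_succ', hG]
    split_ifs <;> ring

end ReLUCalculus

/-! ### Reading a table at a cell number, and monomials in the offsets -/

namespace ReLUCalculus

universe u

variable {X : Type u}

lemma sum_range_mul_eq (F : ℕ → ℝ) (B e : ℕ) :
    ∑ t ∈ Finset.range (B * e), F t =
      ∑ i ∈ Finset.range B, ∑ t ∈ Finset.range e, F (i * e + t) := by
  induction B with
  | zero => simp
  | succ B ih => rw [Nat.succ_mul, Finset.sum_range_add, ih, Finset.sum_range_succ]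

/-- After rescaling by `(A * T)⁻¹`, the quotient is the leading base `A` digit. One layer suffices
and the quotient comes out in unary. -/
lemma reach_divMod {k : X → ℕ} {A T : ℕ} (hT : 0 < T) (hk : ∀ x, k x < A * T) :
    Reach {fun x => (k x : ℝ)} (2 * A + 1) 1
      (funsOf (fun x => k x / T) ∪ {fun x => ((k x % T : ℕ) : ℝ)}) := by
  rcases Nat.eq_zero_or_pos A with rfl | hA
  · have : IsEmpty X := ⟨fun x => by simpa using hk x⟩
    refine Reach.layer (U := ∅) (by simp) (by simp) fun g _ => ?_
    rw [Subsingleton.elim g 0]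
    exact zero_mem _
  have hA' : (0 : ℝ) < A := by exact_mod_cast hA
  have hT' : (0 : ℝ) < T := by exact_mod_cast hT
  set u : X → ℝ := fun x => ((A : ℝ) * T)⁻¹ * k x with hu
  have hTu : ∀ x, (T : ℝ) * (A * u x) = k x := fun x => by
    simp only [hu]; field_simp
  have hb := fun x => digit_bounds (k := k x) hT (v := A * u x) (δ := 1) (hTu x).ge
    (by rw [hTu x]; simp)
  have hd := reach_digit (u := u) (a := fun x => k x / T) (R := A) (δ := 1 / T)
    (by positivity) (fun x => by positivity)
    (fun x => (Nat.div_lt_iff_lt_mul hT).2 (hk x)) (fun x => (hb x).1) (fun x => (hb x).2.1)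
  refine (hd.pre (S' := {fun x => (k x : ℝ)}) ?_).post (Set.union_subset ?_ ?_)
  · rintro _ rfl
    exact aff_mul _ (aff_mem rfl)
  · exact Set.subset_union_right.trans subset_affSpan
  · rintro _ rfl
    have : (fun x => ((k x % T : ℕ) : ℝ)) = fun x => T * (A * u x - (k x / T : ℕ)) := by
      ext x
      have : (k x : ℝ) = T * (k x / T : ℕ) + (k x % T : ℕ) := by
        exact_mod_cast (Nat.div_add_mod (k x) T).symm
      rw [mul_sub, hTu]
      linarith
    rw [this]
    exact aff_mul _ (aff_sub (aff_mul _ (aff_mem (by simp)))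
      (aff_mem (Or.inr (cast_mem_funsOf fun x => k x / T))))

/-- Here the quotient is too large to be held in unary within the width; it is assembled from `l`
digits in base `R`, one per layer, and comes out as a plain number. -/
lemma reach_divMod_deep {k : X → ℕ} {R l Q T : ℕ} (hR : 0 < R) (hT : 0 < T)
    (hk : ∀ x, k x < Q * T) (hQ : Q ≤ R ^ l) :
    Reach {fun x => (k x : ℝ)} (2 * R + 2) l
      {fun x => ((k x / T : ℕ) : ℝ), fun x => ((k x % T : ℕ) : ℝ)} := by
  have hR' : (0 : ℝ) < R := by exact_mod_cast hR
  have hT' : (0 : ℝ) < T := by exact_mod_cast hT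
  set u : X → ℝ := fun x => ((R : ℝ) ^ l * T)⁻¹ * k x with hu
  have hTu : ∀ x, (T : ℝ) * (R ^ l * u x) = k x := fun x => by
    simp only [hu]; field_simp
  have hb := fun x => digit_bounds (k := k x) hT (v := R ^ l * u x) (δ := 1) (hTu x).ge
    (by rw [hTu x]; simp)
  have hd := reach_quantize hR l (u := u) (acc := fun _ => 0) (k := fun x => k x / T) (δ := 1 / T)
    (by positivity) (fun x => by positivity) (fun x => le_rfl)
    (fun x => lt_of_lt_of_le ((Nat.div_lt_iff_lt_mul hT).2 (hk x)) hQ)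
    (fun x => (hb x).1) (fun x => (hb x).2.1)
  refine (hd.pre (S' := {fun x => (k x : ℝ)}) ?_).post ?_
  · rintro _ (rfl | rfl)
    · exact aff_mul _ (aff_mem rfl)
    · exact aff_const 0
  · rintro _ (rfl | rfl)
    · exact aff_mem (by simp)
    · have : (fun x => ((k x % T : ℕ) : ℝ)) = fun x => T * (R ^ l * u x - (k x / T : ℕ)) := by
        ext x
        have : (k x : ℝ) = T * (k x / T : ℕ) + (k x % T : ℕ) := by
          exact_mod_cast (Nat.div_add_mod (k x) T).symm
        rw [mul_sub, hTu]
        linarith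
      rw [this]
      exact aff_mul _ (aff_mem (by simp))

/-- Splitting an index into two digits in unary and two digits as plain numbers. -/
lemma reach_split {j : X → ℕ} {A B R l : ℕ} (hR : 0 < R) (hA : 0 < A) (hB : 0 < B)
    (hBR : B ≤ R ^ l) (hj : ∀ x, j x < A * (A * B ^ 2)) :
    ∃ a b v w : X → ℕ, (∀ x, a x < A) ∧ (∀ x, b x < A) ∧ (∀ x, v x < B) ∧ (∀ x, w x < B) ∧
      (∀ x, j x = ((a x * A + b x) * B + v x) * B + w x) ∧
      Reach {fun x => (j x : ℝ)} (2 * R + 3 * A + 2) (2 + l)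
        (funsOf a ∪ funsOf b ∪ {fun x => (v x : ℝ)} ∪ {fun x => (w x : ℝ)}) := by
  set T := A * B ^ 2 with hT
  have hT0 : 0 < T := by positivity
  have hB2 : 0 < B ^ 2 := by positivity
  set a : X → ℕ := fun x => j x / T
  set k₁ : X → ℕ := fun x => j x % T
  set b : X → ℕ := fun x => k₁ x / B ^ 2
  set k₂ : X → ℕ := fun x => k₁ x % B ^ 2
  have ha : ∀ x, a x < A := fun x => (Nat.div_lt_iff_lt_mul hT0).2 (hj x)
  have hk₁ : ∀ x, k₁ x < A * B ^ 2 := fun x => Nat.mod_lt _ hT0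
  have hb : ∀ x, b x < A := fun x => (Nat.div_lt_iff_lt_mul hB2).2 (hk₁ x)
  have hk₂ : ∀ x, k₂ x < B * B := fun x => by rw [← sq]; exact Nat.mod_lt _ hB2
  refine ⟨a, b, fun x => k₂ x / B, fun x => k₂ x % B, ha, hb,
    fun x => (Nat.div_lt_iff_lt_mul hB).2 (hk₂ x), fun x => Nat.mod_lt _ hB, fun x => ?_, ?_⟩
  · have e1 : T * a x + k₁ x = j x := Nat.div_add_mod (j x) T
    have e2 : B ^ 2 * b x + k₂ x = k₁ x := Nat.div_add_mod (k₁ x) (B ^ 2)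
    have e3 : B * (k₂ x / B) + k₂ x % B = k₂ x := Nat.div_add_mod (k₂ x) B
    calc j x = A * B ^ 2 * a x + (B ^ 2 * b x + (B * (k₂ x / B) + k₂ x % B)) := by
          rw [e3, e2, ← hT, e1]
      _ = _ := by ring
  · have h1 : Reach {fun x => (j x : ℝ)} (2 * R + 3 * A + 2) 1
        (funsOf a ∪ {fun x => (k₁ x : ℝ)}) := (reach_divMod hT0 hj).mono (by omega)
    have h2 : Reach (funsOf a ∪ {fun x => (k₁ x : ℝ)}) (2 * R + 3 * A + 2) 1
        (funsOf a ∪ (funsOf b ∪ {fun x => (k₂ x : ℝ)})) :=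
      ((reach_carry_funsOf ha 1).par (reach_divMod hB2 hk₁)).mono (by omega)
    have h3 : Reach (funsOf a ∪ (funsOf b ∪ {fun x => (k₂ x : ℝ)})) (2 * R + 3 * A + 2) l
        (funsOf a ∪ (funsOf b ∪ {fun x => ((k₂ x / B : ℕ) : ℝ), fun x => ((k₂ x % B : ℕ) : ℝ)})) :=
      ((reach_carry_funsOf ha l).par ((reach_carry_funsOf hb l).par
        (reach_divMod_deep hR hB hk₂ hBR))).mono (by omega)
    refine ((h1.comp h2).comp h3).post (Set.Subset.trans ?_ subset_affSpan)
    rintro g (((hg | hg) | hg) | hg)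
    · exact Or.inl hg
    · exact Or.inr (Or.inl hg)
    · exact Or.inr (Or.inr (Or.inl hg))
    · exact Or.inr (Or.inr (Or.inr hg))

/-- One group of `e` binary digits of a table entry, times `z`. -/
lemma reach_plane {A B e : ℕ} {a b v w : X → ℕ} {z : X → ℝ} {bit : ℕ → ℕ → ℕ}
    (ha : ∀ x, a x < A) (hb : ∀ x, b x < A) (hv : ∀ x, v x < B) (hw : ∀ x, w x < B)
    (hz : ∀ x, 0 ≤ z x) (hz1 : ∀ x, z x ≤ 1) (hbit : ∀ i t, bit i t ≤ 1) :
    Reach (funsOf a ∪ funsOf b ∪ {fun x => (v x : ℝ)} ∪ {fun x => (w x : ℝ), z}) (3 * A + 11)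
      (2 * B + 2 * (B * e))
      {fun x => z x * ∑ t ∈ Finset.range e,
        (bit (((a x * A + b x) * B + v x) * B + w x) t : ℝ) / 2 ^ (t + 1)} := by
  -- The packed number `Y k i j` holds `e` bits for each of the `B` entries that share `(k, i, j)`:
  -- bit `t` is bit `t % e` of entry `t / e`. During extraction the block test `w = t / e` keeps one
  -- entry, and the weights `1 / 2 ^ (t % e + 1)` restore the places.
  set β : ℕ → ℕ → ℕ → ℕ → ℕ := fun k i j t => bit (((i * A + j) * B + k) * B + t / e) (t % e)
  set Y : ℕ → ℕ → ℕ → ℝ := fun k i j =>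
    ∑ t ∈ Finset.range (B * e), (β k i j t : ℝ) / 2 ^ (t + 1)
  have hlook := (reach_lookup (Y := Y) (v := v) ha hb (fun k i j => sum_bits_nonneg _ _)
    (fun k i j => (sum_bits_le _ (b := β k i j) fun t => hbit _ _).trans
      (by simp)) B).frame {fun x => (w x : ℝ), z} (c := 2) (W' := 3 * A + 11)
      (encard_insert_le_of_le _ (encard_singleton_le _ le_rfl) le_rfl)
      (by rintro _ (rfl | rfl)
          · intro x; positivity
          · exact hz) (by omega)
  have hbits := (reach_bits (B * e) (b := fun t x => β (v x) (a x) (b x) t)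
    (c := fun t => 1 / 2 ^ (t % e + 1)) (blk := fun t => t / e) (w := w) (z := z)
    (acc := fun _ => 0) (fun t x => hbit _ _) (fun t => by positivity) hz hz1
    (fun x => le_rfl)).mono (show 11 ≤ 3 * A + 11 by omega)
  refine (hlook.comp (hbits.pre ?_)).post ?_
  · rintro _ (rfl | rfl | rfl | rfl)
    · refine aff_mem (Or.inl (Or.inr ?_))
      simp only [Set.mem_singleton_iff, hv, if_true, Y]
    · exact aff_mem (by simp)
    · exact aff_mem (by simp)
    · exact aff_const 0
  · rintro _ rfl
    refine aff_mem ?_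
    rw [Set.mem_singleton_iff]
    ext x
    symm
    rw [zero_add, sum_range_mul_eq, Finset.sum_eq_single (w x), Finset.mul_sum]
    · refine Finset.sum_congr rfl fun t ht => ?_
      have he : t < e := Finset.mem_range.1 ht
      have h1 : (w x * e + t) / e = w x := by
        rw [mul_comm, Nat.mul_add_div (by omega), Nat.div_eq_of_lt he, add_zero]
      have h2 : (w x * e + t) % e = t := by
        rw [mul_comm, Nat.mul_add_mod, Nat.mod_eq_of_lt he]
      simp only [β, h1, h2, if_true]
      ring
    · intro i _ hi
      refine Finset.sum_eq_zero fun t ht => ?_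
      have he : t < e := Finset.mem_range.1 ht
      have h1 : (i * e + t) / e = i := by
        rw [mul_comm, Nat.mul_add_div (by omega), Nat.div_eq_of_lt he, add_zero]
      rw [h1, if_neg (Ne.symm hi)]
    · intro h
      exact absurd (Finset.mem_range.2 (hw x)) h

/-- A table entry with `n * e` binary digits, times `z`. -/
lemma reach_fetch {A B R l n e : ℕ} {j : X → ℕ} {z : X → ℝ} {bit : ℕ → ℕ → ℕ}
    (hR : 0 < R) (hA : 0 < A) (hB : 0 < B) (hBR : B ≤ R ^ l)
    (hj : ∀ x, j x < A * (A * B ^ 2)) (hz : ∀ x, 0 ≤ z x) (hz1 : ∀ x, z x ≤ 1)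
    (hbit : ∀ i t, bit i t ≤ 1) {W : ℕ} (hW₁ : 2 * R + 3 * A + 3 ≤ W)
    (hW₂ : n * (3 * A + 11) + 1 ≤ W) :
    Reach {fun x => (j x : ℝ), z} W (2 + l + (2 * B + 2 * (B * e)))
      {z, fun x => z x * ∑ t ∈ Finset.range (n * e), (bit (j x) t : ℝ) / 2 ^ (t + 1)} := by
  obtain ⟨a, b, v, w, ha, hb, hv, hw, hjx, hsplit⟩ := reach_split hR hA hB hBR hj
  have h1 := hsplit.frame {z} (encard_singleton_le _ le_rfl) (by rintro _ rfl; exact hz) hW₁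
  -- The digits are shared between width and depth: `n` groups run in parallel, each extracting its
  -- `e` bits sequentially, and are recombined with weights `2 ^ (-p * e)`.
  have h2 := Reach.iUnion (Finset.range n) fun p _ =>
    reach_plane (e := e) (bit := fun i t => bit i (p * e + t)) ha hb hv hw hz hz1
      (fun i t => hbit _ _)
  rw [Finset.card_range] at h2
  have h3 := ((h2.par (Reach.carry (S := {z}) (encard_singleton_le _ le_rfl)
    (by rintro _ rfl; exact hz) _)).mono hW₂)
  have h4 := h1.comp (h3.pre (S' := funsOf a ∪ funsOf b ∪ {fun x => (v x : ℝ)} ∪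
    {fun x => (w x : ℝ)} ∪ {z}) ?_)
  · rw [Set.singleton_union] at h4
    refine h4.post ?_
    rintro _ (rfl | rfl)
    · exact aff_mem (Or.inr rfl)
    · have : (fun x => z x * ∑ t ∈ Finset.range (n * e), (bit (j x) t : ℝ) / 2 ^ (t + 1)) =
          fun x => ∑ p ∈ Finset.range n, (1 / 2 ^ (p * e) : ℝ) * (z x * ∑ t ∈ Finset.range e,
            (bit (((a x * A + b x) * B + v x) * B + w x) (p * e + t) : ℝ) / 2 ^ (t + 1)) := by
        ext x
        rw [sum_range_mul_eq, ← hjx, Finset.mul_sum]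
        refine Finset.sum_congr rfl fun p _ => ?_
        rw [Finset.mul_sum, Finset.mul_sum, Finset.mul_sum]
        refine Finset.sum_congr rfl fun t _ => ?_
        rw [add_assoc, pow_add]
        field_simp
      rw [this]
      refine aff_sum _ fun p hp => aff_mul _ (aff_mem (Or.inl ?_))
      exact Set.mem_biUnion hp rfl
  · refine Set.Subset.trans ?_ subset_affSpan
    rintro g ((((hg | hg) | hg) | (hg | hg)) | hg)
    · exact Or.inl (Or.inl (Or.inl (Or.inl hg)))
    · exact Or.inl (Or.inl (Or.inl (Or.inr hg)))
    · exact Or.inl (Or.inl (Or.inr hg))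
    · exact Or.inl (Or.inr hg)
    · exact Or.inr hg
    · exact Or.inr hg

/-- Truncation of a real number to `[0, c]`. -/
def clamp (c t : ℝ) : ℝ := max 0 (min t c)

lemma clamp_eq {c : ℝ} (hc : 0 ≤ c) (t : ℝ) : clamp c t = max 0 t - max 0 (t - c) := by
  unfold clamp
  rcases le_total t c with h | h
  · rw [min_eq_left h, max_eq_left (show t - c ≤ 0 by linarith), sub_zero]
  · rw [min_eq_right h, max_eq_right hc, max_eq_right (hc.trans h),
      max_eq_right (by linarith)]
    ring

/-- The number of a cell containing a coordinate, and the position inside the cell. -/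
lemma reach_coord {x : X → ℝ} {k : X → ℕ} {R l K : ℕ} {c δ : ℝ} (hR : 0 < R) (hc : 0 ≤ c)
    (hδ : 0 < δ) (hK : K ≤ R ^ l) (hk : ∀ p, k p < K)
    (h1 : ∀ p, (k p : ℝ) ≤ K * clamp c (x p)) (h2 : ∀ p, K * clamp c (x p) ≤ k p + 1 - δ) :
    Reach {x} (2 * R + 2) (1 + l) {fun p => K * clamp c (x p) - k p, fun p => (k p : ℝ)} := by
  have hR' : (0 : ℝ) < R := by exact_mod_cast hR
  have h0 : Reach {x} (2 * R + 2) 1 {fun p => clamp c (x p)} := by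
    refine Reach.layer (U := {relu x, relu fun p => x p - c})
      (encard_insert_le_of_le _ (encard_singleton_le _ le_rfl) (by omega)) ?_ ?_
    · rintro _ (rfl | rfl)
      · exact ⟨_, aff_mem rfl, rfl⟩
      · exact ⟨_, aff_sub (aff_mem rfl) (aff_const _), rfl⟩
    · rintro _ rfl
      simp only [clamp_eq hc]
      exact aff_sub (f := relu x) (g := relu fun p => x p - c) (aff_mem (by simp))
        (aff_mem (by simp))
  -- `K` need not be a power of `R`; the rescaling makes `R ^ l * u` equal to `K * clamp`, whose
  -- integer part is still below `R ^ l`.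
  set u : X → ℝ := fun p => (K / (R : ℝ) ^ l) * clamp c (x p) with hu
  have hRu : ∀ p, (R : ℝ) ^ l * u p = K * clamp c (x p) := fun p => by
    simp only [hu]; field_simp
  have hq := reach_quantize hR l (u := u) (acc := fun _ => 0) (k := k) hδ
    (fun p => mul_nonneg (by positivity) (le_max_left _ _)) (fun _ => le_rfl)
    (fun p => (hk p).trans_le hK) (fun p => by rw [hRu]; exact h1 p)
    (fun p => by rw [hRu]; exact h2 p)
  have := h0.comp (hq.pre (S' := {fun p => clamp c (x p)}) ?_)
  · simpa only [hRu, mul_zero, zero_add] using this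
  · rintro _ (rfl | rfl)
    · exact aff_mul _ (aff_mem rfl)
    · exact aff_const 0

/-- Products of truncated coordinates. -/
lemma reach_prod {d R L k : ℕ} (hR : 0 < R) {δ : ℝ} (hδ : 0 < δ) {u : Fin d → X → ℝ}
    {U : Fin d → X → ℕ} {F : X → ℝ} (hF : ∀ x, 0 ≤ F x) (hu : ∀ i x, 0 ≤ u i x)
    (hU : ∀ i x, U i x < R ^ L) (h1 : ∀ i x, (U i x : ℝ) ≤ R ^ L * u i x)
    (h2 : ∀ i x, R ^ L * u i x ≤ U i x + 1 - δ) (σ : Fin k → Fin d) :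
    Reach (Set.range u ∪ {F}) (2 * R + d + 4) (2 * L * k)
      (Set.range u ∪ {F} ∪ {fun x => ∏ i, ((U (σ i) x : ℝ) / R ^ L)}) := by
  have hR' : (0 : ℝ) < R := by exact_mod_cast hR
  have hfrac0 : ∀ i x, 0 ≤ (U i x : ℝ) / R ^ L := fun i x => by positivity
  have hfrac1 : ∀ i x, (U i x : ℝ) / R ^ L ≤ 1 := fun i x => by
    rw [div_le_one (by positivity)]
    exact_mod_cast (hU i x).le
  induction k with
  | zero =>
    refine Reach.base (Set.union_subset subset_affSpan ?_)
    rintro _ rfl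
    simpa using aff_const (S := Set.range u ∪ {F}) 1
  | succ k ih =>
    set z : X → ℝ := fun x => ∏ i : Fin k, ((U (σ i.castSucc) x : ℝ) / R ^ L) with hz
    have hz0 : ∀ x, 0 ≤ z x := fun x => Finset.prod_nonneg fun i _ => hfrac0 _ _
    have hz1 : ∀ x, z x ≤ 1 := fun x =>
      Finset.prod_le_one (fun i _ => hfrac0 _ _) fun i _ => hfrac1 _ _
    have hmul := reach_mul hR L (u := u (σ (Fin.last k))) (z := z) (acc := fun _ => 0)
      (k := U (σ (Fin.last k))) hδ (hu _) hz0 hz1 (fun _ => le_rfl) (hU _) (h1 _) (h2 _)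
    have hcar : Reach (Set.range u ∪ {F}) (d + 1) (2 * L) (Set.range u ∪ {F}) := by
      refine Reach.carry (encard_union_le_of_le (encard_range_le _ (by simp))
        (encard_singleton_le _ le_rfl) le_rfl) ?_ _
      rintro _ (⟨i, rfl⟩ | rfl)
      · exact hu i
      · exact hF
    have hstep : Reach (Set.range u ∪ {F} ∪ {z}) (2 * R + d + 4) (2 * L)
        (Set.range u ∪ {F} ∪ {fun x => 0 + z x * (U (σ (Fin.last k)) x / R ^ L)}) := by
      refine ((hcar.pre (Set.subset_union_left.trans subset_affSpan)).both
        (hmul.pre ?_)).mono (by omega)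
      rintro _ (rfl | rfl | rfl)
      · exact aff_mem (by simp)
      · exact aff_mem (by simp)
      · exact aff_const 0
    have := (ih fun i => σ i.castSucc).comp hstep
    rw [show 2 * L * (k + 1) = 2 * L * k + 2 * L by ring]
    simpa only [Fin.prod_univ_castSucc, zero_add] using this

/-- A monomial in the truncated positions inside a cell, times a table entry that depends on the
cell. -/
lemma reach_branch {d A B R l L K n e k : ℕ} {c δ : ℝ} {x : Fin d → X → ℝ} {p : Fin d → X → ℕ}
    {bit : ℕ → ℕ → ℕ} (hR : 0 < R) (hA : 0 < A) (hB : 0 < B) (hc : 0 ≤ c) (hδ : 0 < δ)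
    (hBR : B ≤ R ^ l) (hKR : K ≤ R ^ l) (hKd : K ^ d ≤ A * (A * B ^ 2))
    (hp : ∀ i q, p i q < K * R ^ L)
    (h1 : ∀ i q, (p i q : ℝ) ≤ K * R ^ L * clamp c (x i q))
    (h2 : ∀ i q, K * R ^ L * clamp c (x i q) ≤ p i q + 1 - δ)
    (hbit : ∀ i t, bit i t ≤ 1) (σ : Fin k → Fin d) {W : ℕ} (hW₁ : d * (2 * R + 2) ≤ W)
    (hW₂ : 2 * R + d + 4 ≤ W) (hW₃ : 2 * R + 3 * A + 3 ≤ W) (hW₄ : n * (3 * A + 11) + 1 ≤ W) :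
    Reach (Set.range x) W (1 + l + 2 * L * k + (2 + l + (2 * B + 2 * (B * e))))
      {fun q => ∏ i, (((p (σ i) q % R ^ L : ℕ) : ℝ) / R ^ L),
       fun q => (∏ i, (((p (σ i) q % R ^ L : ℕ) : ℝ) / R ^ L)) * ∑ t ∈ Finset.range (n * e),
        (bit (∑ i, p i q / R ^ L * K ^ (i : ℕ)) t : ℝ) / 2 ^ (t + 1)} := by
  have hR' : (0 : ℝ) < R := by exact_mod_cast hR
  have hT : 0 < R ^ L := pow_pos hR L
  have hb := fun i q => digit_bounds (k := p i q) hT (v := K * clamp c (x i q)) (δ := δ)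
    (by push_cast; linarith [h1 i q]) (by push_cast; linarith [h2 i q])
  have hk : ∀ i q, p i q / R ^ L < K := fun i q => (Nat.div_lt_iff_lt_mul hT).2 (hp i q)
  -- The cell number is written in base `K` as `finFunctionFinEquiv` does it, which gives the bound
  -- `K ^ d`.
  set j : X → ℕ := fun q => ∑ i, p i q / R ^ L * K ^ (i : ℕ) with hj
  have hjK : ∀ q, j q < K ^ d := fun q => by
    have := (finFunctionFinEquiv (m := K) (n := d) fun i => ⟨p i q / R ^ L, hk i q⟩).2
    rwa [finFunctionFinEquiv_apply] at this
  set u : Fin d → X → ℝ := fun i q => K * clamp c (x i q) - (p i q / R ^ L : ℕ) with hu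
  have hcoord : Reach (Set.range x) W (1 + l) (Set.range u ∪ {fun q => (j q : ℝ)}) := by
    have := Reach.iUnion (S := Set.range x) (W := 2 * R + 2) (D := 1 + l)
      (T := fun i => {u i, fun q => ((p i q / R ^ L : ℕ) : ℝ)}) (Finset.univ : Finset (Fin d))
      fun i _ => (reach_coord (x := x i) hR hc (δ := δ / (R ^ L : ℕ)) (by positivity) hKR (hk i)
        (fun q => (hb i q).1) (fun q => (hb i q).2.1)).pre
        (by rintro _ rfl; exact aff_mem ⟨i, rfl⟩)
    rw [Finset.card_univ, Fintype.card_fin] at this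
    refine (this.mono hW₁).post (Set.union_subset ?_ ?_)
    · rintro _ ⟨i, rfl⟩
      exact aff_mem (Set.mem_biUnion (Finset.mem_univ i) (by simp))
    · rintro _ rfl
      have e1 : (fun q => (j q : ℝ)) =
          fun q => ∑ i : Fin d, (K : ℝ) ^ (i : ℕ) * ((p i q / R ^ L : ℕ) : ℝ) := by
        ext q
        simp only [hj]
        push_cast
        exact Finset.sum_congr rfl fun i _ => mul_comm _ _
      rw [e1]
      exact aff_sum _ fun i _ => aff_mul _ (aff_mem
        (Set.mem_biUnion (Finset.mem_univ i) (by simp)))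
  -- The passenger `F` of the product network carries the cell number to the lookup.
  have hprod := (reach_prod hR hδ (u := u) (U := fun i q => p i q % R ^ L) (L := L)
    (F := fun q => (j q : ℝ)) (fun q => by positivity) (fun i q => sub_nonneg.2 (hb i q).1)
    (fun i q => Nat.mod_lt _ hT) (fun i q => by simpa using (hb i q).2.2.1)
    (fun i q => by simpa using (hb i q).2.2.2) σ).mono hW₂
  have hfetch := reach_fetch (j := j) (e := e) (n := n) (bit := bit)
    (z := fun q => ∏ i, (((p (σ i) q % R ^ L : ℕ) : ℝ) / R ^ L)) hR hA hB hBR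
    (fun q => (hjK q).trans_le hKd) (fun q => Finset.prod_nonneg fun i _ => by positivity)
    (fun q => Finset.prod_le_one (fun i _ => by positivity) fun i _ => by
      rw [div_le_one (by positivity)]
      exact_mod_cast (Nat.mod_lt _ hT).le) hbit hW₃ hW₄
  refine (hcoord.comp hprod).comp (hfetch.pre ?_)
  rintro _ (rfl | rfl)
  · exact aff_mem (by simp)
  · exact aff_mem (by simp)

end ReLUCalculus

/-! ### Medians of shifted networks -/

namespace ReLUCalculus

universe u

variable {X : Type u}

/-- The median of three real numbers. -/
def median (a b c : ℝ) : ℝ := max a b - max 0 (max a b - c) + max 0 (min a b - c)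

/-- One wrong value out of three cannot move the median out of an interval containing the other two.
-/
lemma median_mem {a b c l u : ℝ}
    (h : (a ∈ Set.Icc l u ∧ b ∈ Set.Icc l u) ∨ (b ∈ Set.Icc l u ∧ c ∈ Set.Icc l u) ∨
      (a ∈ Set.Icc l u ∧ c ∈ Set.Icc l u)) : median a b c ∈ Set.Icc l u := by
  simp only [Set.mem_Icc, median] at *
  rcases le_total a b with h1 | h1 <;>
    simp only [h1, max_eq_left, max_eq_right, min_eq_left, min_eq_right] <;>
    rcases le_total b c with h2 | h2 <;> rcases le_total a c with h3 | h3 <;>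
    simp only [sub_nonneg.2, sub_nonpos.2, h2, h3, max_eq_left, max_eq_right] <;>
    rcases h with h | h | h <;> constructor <;> linarith [h.1.1, h.1.2, h.2.1, h.2.2]

lemma reach_median (a b c : X → ℝ) :
    Reach {a, b, c} 7 2 {fun x => median (a x) (b x) (c x)} := by
  set S : Set (X → ℝ) := {a, b, c}
  have ha : a ∈ affSpan S := aff_mem (by simp [S])
  have hb : b ∈ affSpan S := aff_mem (by simp [S])
  have hc : c ∈ affSpan S := aff_mem (by simp [S])
  have hneg : ∀ {f : X → ℝ} {T : Set (X → ℝ)}, f ∈ affSpan T →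
      (fun x => -f x) ∈ affSpan T := fun h => neg_mem h
  have hpm : ∀ {f : X → ℝ} {T : Set (X → ℝ)}, relu f ∈ T → relu (fun x => -f x) ∈ T →
      f ∈ affSpan T := by
    intro f T h1 h2
    have : f = fun x => relu f x - relu (fun y => -f y) x := by
      ext x
      simp only [relu]
      rcases le_total 0 (f x) with h | h
      · rw [max_eq_right h, max_eq_left (by linarith)]; ring
      · rw [max_eq_left h, max_eq_right (by linarith)]; ring
    rw [this]
    exact aff_sub (aff_mem h1) (aff_mem h2)
  have hmax : ∀ s t : ℝ, max s t = s + max 0 (t - s) := fun s t => by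
    rcases le_total s t with h | h
    · rw [max_eq_right h, max_eq_right (by linarith)]; ring
    · rw [max_eq_left h, max_eq_left (by linarith)]; ring
  have hmin : ∀ s t : ℝ, min s t = t - max 0 (t - s) := fun s t => by
    rcases le_total s t with h | h
    · rw [min_eq_left h, max_eq_right (by linarith)]; ring
    · rw [min_eq_right h, max_eq_left (by linarith)]; ring
  set U : Set (X → ℝ) := {relu a, relu fun x => -a x, relu b, relu fun x => -b x, relu c,
    relu fun x => -c x, relu fun x => b x - a x}
  set q : X → ℝ := fun x => max (a x) (b x) with hq
  set p : X → ℝ := fun x => min (a x) (b x) with hp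
  have h1 : Reach S 7 1 {q, p, c} := by
    refine Reach.layer (U := U) ?_ ?_ ?_
    · iterate 6 refine encard_insert_le_of_le _ ?_ le_rfl
      exact encard_singleton_le _ le_rfl
    · rintro _ (rfl | rfl | rfl | rfl | rfl | rfl | rfl)
      exacts [⟨_, ha, rfl⟩, ⟨_, hneg ha, rfl⟩, ⟨_, hb, rfl⟩, ⟨_, hneg hb, rfl⟩, ⟨_, hc, rfl⟩,
        ⟨_, hneg hc, rfl⟩, ⟨_, aff_sub hb ha, rfl⟩]
    · have ha' : a ∈ affSpan U := hpm (by simp [U]) (by simp [U])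
      have hb' : b ∈ affSpan U := hpm (by simp [U]) (by simp [U])
      have hc' : c ∈ affSpan U := hpm (by simp [U]) (by simp [U])
      have hba : (relu fun x => b x - a x) ∈ affSpan U := aff_mem (by simp [U])
      rintro _ (rfl | rfl | rfl)
      · rw [show q = fun x => a x + relu (fun x => b x - a x) x from funext fun x => hmax _ _]
        exact aff_add ha' hba
      · rw [show p = fun x => b x - relu (fun x => b x - a x) x from funext fun x => hmin _ _]
        exact aff_sub hb' hba
      · exact hc'
  have h2 : Reach {q, p, c} 7 1 {fun x => median (a x) (b x) (c x)} := by
    have hq' : q ∈ affSpan ({q, p, c} : Set (X → ℝ)) := aff_mem (by simp)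
    have hp' : p ∈ affSpan ({q, p, c} : Set (X → ℝ)) := aff_mem (by simp)
    have hc' : c ∈ affSpan ({q, p, c} : Set (X → ℝ)) := aff_mem (by simp)
    refine Reach.layer (U := {relu q, relu fun x => -q x, relu fun x => q x - c x,
      relu fun x => p x - c x}) ?_ ?_ ?_
    · iterate 3 refine encard_insert_le_of_le _ ?_ le_rfl
      exact encard_singleton_le _ (by norm_num)
    · rintro _ (rfl | rfl | rfl | rfl)
      exacts [⟨_, hq', rfl⟩, ⟨_, hneg hq', rfl⟩, ⟨_, aff_sub hq' hc', rfl⟩,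
        ⟨_, aff_sub hp' hc', rfl⟩]
    · rintro _ rfl
      refine aff_add (f := fun x => q x - relu (fun x => q x - c x) x)
        (g := relu fun x => p x - c x) (aff_sub ?_ (aff_mem (by simp))) (aff_mem (by simp))
      exact hpm (by simp) (by simp)
  exact h1.comp h2

/-- The coordinate functions. -/
def coords (d : ℕ) : Set ((Fin d → ℝ) → ℝ) := Set.range fun i x => x i

lemma reach_shift {d W D : ℕ} {g : (Fin d → ℝ) → ℝ} (h : Reach (coords d) W D {g}) (i : Fin d)
    (t : ℝ) : Reach (coords d) W D {fun x => g (Function.update x i (x i + t))} := by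
  have h1 := h.comap fun x : Fin d → ℝ => Function.update x i (x i + t)
  rw [Set.image_singleton] at h1
  refine h1.pre ?_
  rintro _ ⟨_, ⟨j, rfl⟩, rfl⟩
  have : ((fun x : Fin d → ℝ => x j) ∘ fun x : Fin d → ℝ => Function.update x i (x i + t)) =
      fun x => x j + if j = i then t else 0 := by
    ext x
    by_cases hj : j = i
    · subst hj; simp
    · simp [hj]
  dsimp only
  rw [this]
  exact aff_add (aff_mem ⟨j, rfl⟩) (aff_const _)

/-- Taking medians over small shifts, coordinate by coordinate, removes the exceptional set of an
approximation that is valid only where all coordinates are good. -/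
lemma exists_median_network {d W D : ℕ} (hW : 3 ≤ W) {g : (Fin d → ℝ) → ℝ}
    (hg : Reach (coords d) W D {g}) {C : Set (Fin d → ℝ)} {F : (Fin d → ℝ) → ℝ} {good : ℝ → Prop}
    {η ε : ℝ} (hη : 0 ≤ η)
    (hgood : ∀ t, (good (t + -η) ∧ good t) ∨ (good t ∧ good (t + η)) ∨
      (good (t + -η) ∧ good (t + η)))
    (happ : ∀ x ∈ C, ∀ y : Fin d → ℝ, (∀ i, |y i - x i| ≤ η ∧ good (y i)) → |g y - F x| ≤ ε) :
    ∃ φ : (Fin d → ℝ) → ℝ, Reach (coords d) (3 ^ d * W) (D + 2 * d) {φ} ∧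
      ∀ x ∈ C, |φ x - F x| ≤ ε := by
  -- Invariant: the first `m` coordinates have been repaired and are evaluated at `x` itself, good
  -- or not; the others may still be perturbed by `η`, but must be good.
  suffices H : ∀ m ≤ d, ∃ φ : (Fin d → ℝ) → ℝ, Reach (coords d) (3 ^ m * W) (D + 2 * m) {φ} ∧
      ∀ x ∈ C, ∀ y : Fin d → ℝ, (∀ i : Fin d, (i : ℕ) < m → y i = x i) →
        (∀ i : Fin d, m ≤ (i : ℕ) → |y i - x i| ≤ η ∧ good (y i)) → |φ y - F x| ≤ ε by
    obtain ⟨φ, h1, h2⟩ := H d le_rfl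
    exact ⟨φ, h1, fun x hx => h2 x hx x (fun _ _ => rfl) fun i hi => absurd i.2 (not_lt.2 hi)⟩
  intro m
  induction m with
  | zero =>
    intro _
    exact ⟨g, by simpa using hg, fun x hx y _ hy => happ x hx y fun i => hy i (Nat.zero_le _)⟩
  | succ m ih =>
    intro hm
    obtain ⟨φ, h1, h2⟩ := ih (by omega)
    set i : Fin d := ⟨m, hm⟩
    set sh : ℝ → (Fin d → ℝ) → ℝ := fun t x => φ (Function.update x i (x i + t)) with hsh
    have hred : ∀ t, Reach (coords d) (3 ^ m * W) (D + 2 * m) {sh t} := fun t =>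
      reach_shift h1 i t
    refine ⟨fun x => median (sh (-η) x) (φ x) (sh η x), ?_, fun x hx y hy1 hy2 => ?_⟩
    · have hall := ((hred (-η)).both (h1.both (hred η))).mono
        (show 3 ^ m * W + (3 ^ m * W + 3 ^ m * W) ≤ 3 ^ (m + 1) * W by rw [pow_succ]; linarith)
      have hmed := (reach_median (sh (-η)) φ (sh η)).mono
        (show 7 ≤ 3 ^ (m + 1) * W by
          have : 1 ≤ 3 ^ m := Nat.one_le_pow _ _ (by norm_num)
          calc 7 ≤ 1 * 3 * 3 := by norm_num
            _ ≤ 3 ^ m * 3 * W := by gcongr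
            _ = _ := by rw [pow_succ])
      have := hall.comp (hmed.pre (by
        refine Set.Subset.trans ?_ subset_affSpan
        rintro _ (rfl | rfl | rfl) <;> simp))
      rwa [show D + 2 * m + 2 = D + 2 * (m + 1) by ring] at this
    · have hyi : y i = x i := hy1 i (Nat.lt_succ_self m)
      have key : ∀ t, |t| ≤ η → good (y i + t) →
          sh t y ∈ Set.Icc (F x - ε) (F x + ε) := by
        intro t ht hgt
        have : |sh t y - F x| ≤ ε := by
          refine h2 x hx _ (fun k hk => ?_) fun k hk => ?_
          · rw [Function.update_of_ne (by rintro rfl; simp [i] at hk)]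
            exact hy1 k (by omega)
          · by_cases hki : k = i
            · subst hki
              rw [Function.update_self]
              exact ⟨by rw [hyi]; simpa using ht, hgt⟩
            · rw [Function.update_of_ne hki]
              exact hy2 k (by
                have : (k : ℕ) ≠ m := fun h => hki (Fin.ext h)
                omega)
        rw [abs_le] at this
        constructor <;> linarith [this.1, this.2]
      have key0 : good (y i) → φ y ∈ Set.Icc (F x - ε) (F x + ε) := fun h => by
        have := key 0 (by simpa using hη) (by simpa using h)
        simpa [hsh] using this
      have hη1 : |-η| ≤ η := by rw [abs_neg, abs_of_nonneg hη]
      have hη2 : |η| ≤ η := by rw [abs_of_nonneg hη]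
      have := median_mem (l := F x - ε) (u := F x + ε) (a := sh (-η) y) (b := φ y) (c := sh η y)
        (by
          rcases hgood (y i) with h | h | h
          · exact Or.inl ⟨key _ hη1 h.1, key0 h.2⟩
          · exact Or.inr (Or.inl ⟨key0 h.1, key _ hη2 h.2⟩)
          · exact Or.inr (Or.inr ⟨key _ hη1 h.1, key _ hη2 h.2⟩))
      rw [abs_le]
      constructor <;> linarith [this.1, this.2]

/-! ### Turning layered computations into networks of exact width and depth -/

/-- An affine map in front of a network can be absorbed. -/
lemma exists_net_comp_affine {n k k' : ℕ} (ψ : ReLUNet n k) (A : Matrix (Fin k) (Fin k') ℝ)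
    (b : Fin k → ℝ) : ∃ φ : ReLUNet n k', φ.depth = ψ.depth ∧ φ.width = ψ.width ∧
      ∀ x, φ.eval x = ψ.eval (A.mulVec x + b) := by
  cases ψ with
  | affine A' b' =>
    refine ⟨.affine (A' * A) (A'.mulVec b + b'), rfl, rfl, fun x => ?_⟩
    simp [ReLUNet.eval, Matrix.mulVec_add, add_assoc]
  | layer A' b' rest =>
    refine ⟨.layer (A' * A) (A'.mulVec b + b') rest, rfl, rfl, fun x => ?_⟩
    simp [ReLUNet.eval, Matrix.mulVec_add, add_assoc]

lemma exists_net_of_mem_affSpan {n k k' : ℕ} (ψ : ReLUNet n k) {e : Fin k → X → ℝ}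
    {e' : Fin k' → X → ℝ} (h : ∀ i, e i ∈ affSpan (Set.range e')) :
    ∃ φ : ReLUNet n k', φ.depth = ψ.depth ∧ φ.width = ψ.width ∧
      ∀ x, φ.eval (fun i => e' i x) = ψ.eval (fun i => e i x) := by
  choose a c hac using fun i => exists_of_mem_affSpan_range (h i)
  obtain ⟨φ, h1, h2, h3⟩ := exists_net_comp_affine ψ (Matrix.of a) c
  refine ⟨φ, h1, h2, fun x => ?_⟩
  rw [h3]
  congr 1
  ext i
  simp [Matrix.mulVec, dotProduct, hac i x]

/-- Zero neurons pad a layer to exactly `W`, because the width is prescribed and not merely bounded.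
-/
lemma exists_enum {U : Set (X → ℝ)} {W : ℕ} (hU : U.encard ≤ W) :
    ∃ e : Fin W → X → ℝ, U ⊆ Set.range e ∧ ∀ i, e i ∈ insert 0 U := by
  have hfin : U.Finite := Set.finite_of_encard_le_coe hU
  lift U to Finset (X → ℝ) using hfin
  rw [Set.encard_coe_eq_coe_finsetCard] at hU
  have hU' : U.card ≤ W := by exact_mod_cast hU
  refine ⟨fun i => if h : (i : ℕ) < U.card then (U.equivFin.symm ⟨i, h⟩ : X → ℝ) else 0, ?_, ?_⟩
  · intro g hg
    refine ⟨⟨U.equivFin ⟨g, hg⟩, (U.equivFin ⟨g, hg⟩).2.trans_le hU'⟩, ?_⟩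
    simp
  · intro i
    by_cases h : (i : ℕ) < U.card
    · simp only [h, dite_true]
      exact Or.inr (U.equivFin.symm ⟨i, h⟩).2
    · simp [h]

/-- The network is built from its output end: `ψ` is the part already built, and the induction
prepends layers to it. -/
lemma Reach.exists_net {d n W D : ℕ} {T : Set ((Fin d → ℝ) → ℝ)} (h : Reach (coords d) W D T) :
    ∀ {k : ℕ} (ψ : ReLUNet n k) {e : Fin k → (Fin d → ℝ) → ℝ}, (∀ i, e i ∈ affSpan T) →
      ∃ φ : ReLUNet n d, φ.depth = D + ψ.depth ∧
        φ.width = (if D = 0 then ψ.width else max W ψ.width) ∧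
        ∀ x, φ.eval x = ψ.eval (fun i => e i x) := by
  induction h with
  | base h =>
    intro k ψ e he
    have he' : ∀ i, e i ∈ affSpan (coords d) := fun i => affSpan_le h (he i)
    obtain ⟨φ, h1, h2, h3⟩ := exists_net_of_mem_affSpan ψ
      (e' := fun (i : Fin d) (x : Fin d → ℝ) => x i) he'
    exact ⟨φ, by simpa using h1, by simpa using h2, h3⟩
  | @step D T U V _ hc hU hV ih =>
    intro k ψ e he
    obtain ⟨e', he1, he2⟩ := exists_enum hc
    obtain ⟨ψ', h1, h2, h3⟩ := exists_net_of_mem_affSpan ψ (e' := e') fun i =>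
      affSpan_mono he1 (affSpan_le hV (he i))
    have hpre : ∀ i, ∃ p ∈ affSpan T, e' i = relu p := by
      intro i
      rcases he2 i with h | h
      · exact ⟨0, zero_mem _, by rw [h]; ext x; simp [relu]⟩
      · exact hU _ h
    choose p hp1 hp2 using hpre
    -- The new layer has identity weights: its preactivations `p i` lie in `affSpan T` and are
    -- themselves the inputs handed to the earlier layers.
    obtain ⟨φ, g1, g2, g3⟩ := ih (.layer (1 : Matrix (Fin W) (Fin W) ℝ) 0 ψ') hp1
    refine ⟨φ, ?_, ?_, fun x => ?_⟩
    · rw [g1]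
      simp only [ReLUNet.depth, h1]
      ring
    · rw [g2]
      simp only [ReLUNet.width, h2]
      split_ifs <;> simp_all
    · rw [g3, ← h3]
      simp only [ReLUNet.eval, Matrix.one_mulVec, add_zero]
      congr 1
      ext i
      rw [hp2]; rfl

lemma Reach.exists_net_eq {d W D : ℕ} {g : (Fin d → ℝ) → ℝ} (h : Reach (coords d) W D {g})
    (hD : D ≠ 0) : ∃ φ : ReLUNet 1 d, φ.width = W ∧ φ.depth = D ∧ ∀ x, φ.eval x 0 = g x := by
  obtain ⟨φ, h1, h2, h3⟩ := h.exists_net (.affine (1 : Matrix (Fin 1) (Fin 1) ℝ) 0)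
    (e := fun _ => g) fun _ => aff_mem rfl
  refine ⟨φ, ?_, by simpa [ReLUNet.depth] using h1, fun x => ?_⟩
  · simpa [ReLUNet.width, hD] using h2
  · simp [h3, ReLUNet.eval]

end ReLUCalculus

/-! ### Taylor's formula on the closed cube -/

namespace HolderCube

open scoped Nat

variable {d : ℕ}

lemma convex_unitCube : Convex ℝ (unitCube d) := by
  intro x hx y hy a b ha hb hab i
  simpa using (convex_Icc (0 : ℝ) 1) (hx i) (hy i) ha hb hab

lemma interior_unitCube_nonempty : (interior (unitCube d)).Nonempty := by
  have hopen : IsOpen {x : EuclideanSpace ℝ (Fin d) | ∀ i, x i ∈ Set.Ioo (0 : ℝ) 1} := by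
    rw [Set.ofPred_forall]
    refine isOpen_iInter_of_finite fun i => isOpen_Ioo.preimage ?_
    fun_prop
  refine ⟨WithLp.toLp 2 fun _ => 1 / 2, interior_maximal (fun x hx i => ?_) hopen ?_⟩
  · exact Set.Ioo_subset_Icc_self (hx i)
  · intro i
    norm_num

lemma uniqueDiffOn_unitCube : UniqueDiffOn ℝ (unitCube d) :=
  uniqueDiffOn_convex convex_unitCube interior_unitCube_nonempty

lemma subset_closure_interior : unitCube d ⊆ closure (interior (unitCube d)) := by
  rw [convex_unitCube.closure_interior_eq_closure_of_nonempty_interior interior_unitCube_nonempty]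
  exact subset_closure

variable {f g : EuclideanSpace ℝ (Fin d) → ℝ} {x y : EuclideanSpace ℝ (Fin d)} {s : ℕ}
  {r B₀ : ℝ}

/-- The line through `x` meets the cube in a nondegenerate segment, even when `x` is on a face, so
the one-sided derivative is unique. -/
lemma cubePartial_eq_fderivWithin (hg : DifferentiableWithinAt ℝ g (unitCube d) x)
    (hx : x ∈ unitCube d) (i : Fin d) :
    cubePartial i g x = fderivWithin ℝ g (unitCube d) x (EuclideanSpace.single i 1) := by
  refine HasDerivWithinAt.derivWithin
    (hg.hasFDerivWithinAt.hasLineDerivWithinAt (EuclideanSpace.single i 1)) ?_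
  have : (fun t : ℝ => x + t • EuclideanSpace.single i (1 : ℝ)) ⁻¹' unitCube d =
      Set.Icc (-x i) (1 - x i) := by
    ext t
    constructor
    · intro h
      have := h i
      simp only [PiLp.add_apply, PiLp.smul_apply, PiLp.single_apply, if_true, smul_eq_mul,
        mul_one, Set.mem_Icc] at this
      constructor <;> linarith [this.1, this.2]
    · intro h j
      by_cases hj : j = i
      · subst hj
        simp only [PiLp.add_apply, PiLp.smul_apply, PiLp.single_apply, if_true, smul_eq_mul,
          mul_one, Set.mem_Icc]
        constructor <;> linarith [h.1, h.2]
      · simpa [hj] using hx j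
  rw [this]
  refine uniqueDiffOn_Icc (by linarith) 0 ⟨?_, ?_⟩ <;> linarith [(hx i).1, (hx i).2]

lemma cubePartial_congr (h : Set.EqOn f g (unitCube d)) (i : Fin d) :
    Set.EqOn (cubePartial i f) (cubePartial i g) (unitCube d) := fun _ hx =>
  lineDerivWithin_congr' h hx

lemma contDiffOn_cubePartial {n : ℕ} (hg : ContDiffOn ℝ (n + 1 : ℕ) g (unitCube d)) (i : Fin d) :
    ContDiffOn ℝ n (cubePartial i g) (unitCube d) := by
  have h1 : ContDiffOn ℝ n (fun x => fderivWithin ℝ g (unitCube d) x (EuclideanSpace.single i 1))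
      (unitCube d) :=
    (hg.fderivWithin uniqueDiffOn_unitCube (by push_cast; exact le_rfl)).clm_apply contDiffOn_const
  refine h1.congr fun x hx => cubePartial_eq_fderivWithin ?_ hx i
  exact (hg.differentiableOn (by simp)) x hx

/-- Symmetry of the second derivative holds up to the boundary because the cube is contained in the
closure of its interior. -/
lemma cubePartial_comm (hg : ContDiffOn ℝ 2 g (unitCube d)) (i j : Fin d) :
    Set.EqOn (cubePartial i (cubePartial j g)) (cubePartial j (cubePartial i g)) (unitCube d) := by
  have h1 : ∀ j, Set.EqOn (cubePartial j g)
      (fun x => fderivWithin ℝ g (unitCube d) x (EuclideanSpace.single j 1)) (unitCube d) :=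
    fun j x hx => cubePartial_eq_fderivWithin ((hg.differentiableOn (by simp)) x hx) hx j
  have hD : ContDiffOn ℝ 1 (fderivWithin ℝ g (unitCube d)) (unitCube d) :=
    hg.fderivWithin uniqueDiffOn_unitCube (by norm_num)
  have h2 : ∀ i j, Set.EqOn (cubePartial i (cubePartial j g)) (fun x =>
      fderivWithin ℝ (fderivWithin ℝ g (unitCube d)) (unitCube d) x (EuclideanSpace.single i 1)
        (EuclideanSpace.single j 1)) (unitCube d) := by
    intro i j x hx
    have hDx := (hD.differentiableOn (by simp)) x hx
    have hv := hDx.hasFDerivWithinAt.clm_apply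
      (hasFDerivWithinAt_const (EuclideanSpace.single j (1 : ℝ)) x (unitCube d))
    rw [cubePartial_congr (h1 j) i hx, cubePartial_eq_fderivWithin hv.differentiableWithinAt hx,
      hv.fderivWithin (uniqueDiffOn_unitCube x hx)]
    simp
  intro x hx
  rw [h2 i j hx, h2 j i hx]
  exact (hg x hx).isSymmSndFDerivWithinAt (by simp) uniqueDiffOn_unitCube
    (subset_closure_interior hx) hx _ _

/-- Iterated partial derivatives along a list of directions. -/
noncomputable def listDeriv (l : List (Fin d)) (f : EuclideanSpace ℝ (Fin d) → ℝ) :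
    EuclideanSpace ℝ (Fin d) → ℝ :=
  l.foldr cubePartial f

lemma contDiffOn_listDeriv (l : List (Fin d)) :
    ∀ {n : ℕ}, ContDiffOn ℝ (n + l.length : ℕ) f (unitCube d) →
      ContDiffOn ℝ n (listDeriv l f) (unitCube d) := by
  induction l with
  | nil => intro n h; simpa [listDeriv] using h
  | cons i l ih =>
    intro n h
    refine contDiffOn_cubePartial (ih ?_) i
    convert h using 2
    simp; ring

lemma listDeriv_perm {l l' : List (Fin d)} (h : l.Perm l')
    (hf : ContDiffOn ℝ l.length f (unitCube d)) :
    Set.EqOn (listDeriv l f) (listDeriv l' f) (unitCube d) := by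
  induction h with
  | nil => exact Set.eqOn_refl _ _
  | cons i _ ih =>
    exact cubePartial_congr (ih (hf.of_le (by simp))) i
  | swap i j l =>
    refine cubePartial_comm (g := listDeriv l f) ?_ j i
    refine contDiffOn_listDeriv (n := 2) l ?_
    convert hf using 2
    simp; ring
  | trans h₁ _ ih₁ ih₂ =>
    exact (ih₁ hf).trans (ih₂ (by rwa [← h₁.length_eq]))

lemma cubeDeriv_eq_listDeriv (α : Fin d → ℕ) (f : EuclideanSpace ℝ (Fin d) → ℝ) :
    cubeDeriv α f = listDeriv ((List.finRange d).flatMap fun i => List.replicate (α i) i) f := by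
  have h : ∀ (i : Fin d) (n : ℕ) (g : EuclideanSpace ℝ (Fin d) → ℝ),
      (cubePartial i)^[n] g = (List.replicate n i).foldr cubePartial g := by
    intro i n g
    induction n with
    | zero => rfl
    | succ n ih => rw [Function.iterate_succ_apply', ih, List.replicate_succ, List.foldr_cons]
  rw [listDeriv, List.foldr_flatMap, cubeDeriv]
  simp only [h]

/-- `cubeDeriv` differentiates in a fixed order, whereas Taylor's formula along a line yields words
in every order; sorting the word carries the Hölder bounds over. -/
lemma listDeriv_eqOn_cubeDeriv (l : List (Fin d)) (hf : ContDiffOn ℝ l.length f (unitCube d)) :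
    ∑ i, l.count i = l.length ∧
      Set.EqOn (listDeriv l f) (cubeDeriv (fun i => l.count i) f) (unitCube d) := by
  have hperm : l.Perm ((List.finRange d).flatMap fun i => List.replicate (l.count i) i) := by
    rw [List.perm_iff_count]
    intro j
    rw [List.count_flatMap, ← Fin.sum_univ_def]
    simp [List.count_replicate]
  refine ⟨?_, ?_⟩
  · conv_rhs => rw [hperm.length_eq, List.length_flatMap, ← Fin.sum_univ_def]
    simp
  · rw [cubeDeriv_eq_listDeriv]
    exact listDeriv_perm hperm hf

lemma abs_listDeriv_le (hf : f ∈ holderClass d s r B₀) {l : List (Fin d)} (hl : l.length ≤ s)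
    (hx : x ∈ unitCube d) : |listDeriv l f x| ≤ B₀ := by
  obtain ⟨h1, h2⟩ := listDeriv_eqOn_cubeDeriv l (hf.1.of_le (by exact_mod_cast hl))
  rw [h2 hx]
  exact hf.2.1 _ (h1.trans_le hl) x hx

lemma abs_listDeriv_sub_le (hf : f ∈ holderClass d s r B₀) {l : List (Fin d)} (hl : l.length = s)
    (hx : x ∈ unitCube d) (hy : y ∈ unitCube d) :
    |listDeriv l f x - listDeriv l f y| ≤ B₀ * ‖x - y‖ ^ r := by
  obtain ⟨h1, h2⟩ := listDeriv_eqOn_cubeDeriv l (hf.1.of_le (by exact_mod_cast hl.le))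
  rw [h2 hx, h2 hy]
  exact hf.2.2 _ (h1.trans hl) x hx y hy

/-- One-dimensional Taylor estimate for a chain of successive derivatives. -/
lemma abs_sub_taylor_le {C : ℝ} (s : ℕ) : ∀ {G : ℕ → ℝ → ℝ},
    (∀ k < s, ∀ t ∈ Set.Icc (0 : ℝ) 1, HasDerivWithinAt (G k) (G (k + 1) t) (Set.Icc 0 1) t) →
    (∀ t ∈ Set.Icc (0 : ℝ) 1, |G s t - G s 0| ≤ C) → ∀ t ∈ Set.Icc (0 : ℝ) 1,
      |G 0 t - ∑ k ∈ Finset.range (s + 1), G k 0 * (t ^ k / k !)| ≤ C * (t ^ s / s !) := by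
  induction s with
  | zero =>
    intro G _ h t ht
    simpa using h t ht
  | succ s ih =>
    intro G hG h t ht
    have hder := ih (G := fun k => G (k + 1)) (fun k hk => hG (k + 1) (by omega)) h
    have hpow : ∀ (k : ℕ) (t : ℝ),
        HasDerivAt (fun t : ℝ => t ^ (k + 1) / (k + 1)!) (t ^ k / k !) t := by
      intro k t
      refine ((hasDerivAt_pow (k + 1) t).div_const _).congr_deriv ?_
      rw [Nat.factorial_succ]
      push_cast
      field_simp
    have hF : ∀ t ∈ Set.Icc (0 : ℝ) 1, HasDerivWithinAt
        (fun t => G 0 t - ∑ k ∈ Finset.range (s + 2), G k 0 * (t ^ k / k !))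
        (G 1 t - ∑ k ∈ Finset.range (s + 1), G (k + 1) 0 * (t ^ k / k !)) (Set.Icc 0 1) t := by
      intro t ht
      simp only [Finset.sum_range_succ' _ (s + 1)]
      refine (hG 0 (by omega) t ht).sub ?_
      have h1 : HasDerivAt
          (fun t => ∑ k ∈ Finset.range (s + 1), G (k + 1) 0 * (t ^ (k + 1) / (k + 1)!))
          (∑ k ∈ Finset.range (s + 1), G (k + 1) 0 * (t ^ k / k !)) t :=
        HasDerivAt.fun_sum fun k _ => (hpow k t).const_mul _
      simpa using (h1.add_const (G 0 0)).hasDerivWithinAt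
    -- The derivative of the remainder is the remainder of the shifted chain, bounded by `C * t ^ s
    -- / s !`; the remainder vanishes at `0`, so integrating this bound suffices.
    refine image_norm_le_of_norm_deriv_right_le_deriv_boundary
      (f' := fun t => G 1 t - ∑ k ∈ Finset.range (s + 1), G (k + 1) 0 * (t ^ k / k !))
      (B' := fun t => C * (t ^ s / s !))
      (fun t ht => (hF t ht).continuousWithinAt)
      (fun t ht => (hF t ⟨ht.1, ht.2.le⟩).mono_of_mem_nhdsWithin (Icc_mem_nhdsGE_of_mem ht))
      ?_ (fun t => (hpow s t).const_mul C) (fun t ht => hder t ⟨ht.1, ht.2.le⟩) ht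
    simp [Finset.sum_range_succ' _ (s + 1)]

/-- The homogeneous part of degree `k` of the Taylor polynomial of `f` at `x`, times `k!`. -/
noncomputable def taylorPart (f : EuclideanSpace ℝ (Fin d) → ℝ)
    (x h : EuclideanSpace ℝ (Fin d)) (k : ℕ) : ℝ :=
  ∑ σ : Fin k → Fin d, (∏ i, h (σ i)) * listDeriv (List.ofFn σ) f x

/-- Differentiating along `h` prepends one letter to each word. Summing over words instead of
multi-indices avoids multinomial coefficients. -/
lemma hasDerivWithinAt_taylorPart (hf : ContDiffOn ℝ s f (unitCube d)) (hx : x ∈ unitCube d)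
    {h : EuclideanSpace ℝ (Fin d)} (hxh : x + h ∈ unitCube d) {k : ℕ} (hk : k < s) {t : ℝ}
    (ht : t ∈ Set.Icc (0 : ℝ) 1) :
    HasDerivWithinAt (fun t => taylorPart f (x + t • h) h k) (taylorPart f (x + t • h) h (k + 1))
      (Set.Icc 0 1) t := by
  have hmaps : Set.MapsTo (fun t : ℝ => x + t • h) (Set.Icc 0 1) (unitCube d) := fun t ht => by
    simpa using convex_unitCube.add_smul_sub_mem hx hxh ht
  have hterm : ∀ l : List (Fin d), l.length = k →
      HasDerivWithinAt (fun t => listDeriv l f (x + t • h))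
        (∑ i, h i * listDeriv (i :: l) f (x + t • h)) (Set.Icc 0 1) t := by
    intro l hl
    have hc : ContDiffOn ℝ 1 (listDeriv l f) (unitCube d) :=
      contDiffOn_listDeriv (n := 1) l (hf.of_le (by rw [hl]; exact_mod_cast (by omega)))
    have hd := hc.differentiableOn (by simp) _ (hmaps ht)
    have hline : HasDerivWithinAt (fun t : ℝ => x + t • h) h (Set.Icc 0 1) t := by
      simpa using (((hasDerivAt_id t).smul_const h).const_add x).hasDerivWithinAt
    refine (hd.hasFDerivWithinAt.comp_hasDerivWithinAt t hline hmaps).congr_deriv ?_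
    have hsum : ∀ T : EuclideanSpace ℝ (Fin d) →L[ℝ] ℝ,
        T h = ∑ i, h i * T (EuclideanSpace.single i 1) := by
      intro T
      have hh : h = ∑ i, h i • EuclideanSpace.single i (1 : ℝ) := by
        ext j
        simp [Pi.single_apply]
      conv_lhs => rw [hh]
      simp
    rw [hsum]
    refine Finset.sum_congr rfl fun i _ => ?_
    exact congrArg _ (cubePartial_eq_fderivWithin hd (hmaps ht) i).symm
  have hsum := HasDerivWithinAt.fun_sum (u := (Finset.univ : Finset (Fin k → Fin d)))
    fun σ _ => (hterm (List.ofFn σ) (by simp)).const_mul (∏ i, h (σ i))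
  refine hsum.congr_deriv ?_
  rw [taylorPart, ← (Fin.consEquiv fun _ => Fin d).sum_comp, Fintype.sum_prod_type_right]
  refine Finset.sum_congr rfl fun σ _ => ?_
  rw [Finset.mul_sum]
  refine Finset.sum_congr rfl fun i _ => ?_
  simp [Fin.consEquiv, Fin.prod_univ_succ, List.ofFn_succ]
  ring

lemma sum_prod_abs (h : EuclideanSpace ℝ (Fin d)) (k : ℕ) :
    ∑ σ : Fin k → Fin d, |∏ i, h (σ i)| = (∑ i, |h i|) ^ k := by
  rw [Fintype.sum_pow]
  exact Finset.sum_congr rfl fun σ _ => Finset.abs_prod _ _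

/-- The one-dimensional estimate applied to `t ↦ f (x + t • h)`: along the segment the `s`-th
derivative varies by at most the Hölder bound, summed over all words with weights of total `(∑ |h
i|) ^ s`. -/
lemma abs_sub_taylor_sum_le (hB : 0 ≤ B₀) (hr : 0 ≤ r) (hf : f ∈ holderClass d s r B₀)
    (hx : x ∈ unitCube d) {h : EuclideanSpace ℝ (Fin d)} (hxh : x + h ∈ unitCube d) :
    |f (x + h) - ∑ k ∈ Finset.range (s + 1), taylorPart f x h k / k !| ≤
      B₀ * (∑ i, |h i|) ^ s * ‖h‖ ^ r / s ! := by
  have hmaps : ∀ t ∈ Set.Icc (0 : ℝ) 1, x + t • h ∈ unitCube d := fun t ht => by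
    simpa using convex_unitCube.add_smul_sub_mem hx hxh ht
  have key := abs_sub_taylor_le s (C := (∑ i, |h i|) ^ s * (B₀ * ‖h‖ ^ r))
    (G := fun k t => taylorPart f (x + t • h) h k)
    (fun k hk t ht => hasDerivWithinAt_taylorPart hf.1 hx hxh hk ht) (fun t ht => ?_) 1 (by simp)
  · have e0 : taylorPart f (x + (1 : ℝ) • h) h 0 = f (x + h) := by
      simp [taylorPart, listDeriv]
    simp only [e0, zero_smul, add_zero, one_pow, mul_one_div] at key
    refine key.trans (le_of_eq ?_)
    ring
  · simp only [taylorPart, zero_smul, add_zero, ← Finset.sum_sub_distrib, ← mul_sub]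
    refine (Finset.abs_sum_le_sum_abs _ _).trans ?_
    rw [← sum_prod_abs, Finset.sum_mul]
    refine Finset.sum_le_sum fun σ _ => ?_
    rw [abs_mul]
    refine mul_le_mul_of_nonneg_left ?_ (abs_nonneg _)
    refine (abs_listDeriv_sub_le hf (by simp) (hmaps t ht) hx).trans ?_
    have : ‖x + t • h - x‖ ≤ ‖h‖ := by
      rw [add_sub_cancel_left, norm_smul, Real.norm_eq_abs, abs_of_nonneg ht.1]
      exact mul_le_of_le_one_left (norm_nonneg _) ht.2
    gcongr

/-- Bounds the effect of rounding the point when first derivatives exist; for `s = 0` the Hölder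
condition takes this role. -/
lemma abs_sub_le_of_one_le (hf : f ∈ holderClass d s r B₀) (hs : 1 ≤ s)
    (hx : x ∈ unitCube d) {h : EuclideanSpace ℝ (Fin d)} (hxh : x + h ∈ unitCube d) :
    |f (x + h) - f x| ≤ B₀ * ∑ i, |h i| := by
  have hmaps : ∀ t ∈ Set.Icc (0 : ℝ) 1, x + t • h ∈ unitCube d := fun t ht => by
    simpa using convex_unitCube.add_smul_sub_mem hx hxh ht
  have key := (convex_Icc (0 : ℝ) 1).norm_image_sub_le_of_norm_hasDerivWithin_le
    (f := fun t => taylorPart f (x + t • h) h 0) (C := B₀ * ∑ i, |h i|)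
    (fun t ht => hasDerivWithinAt_taylorPart hf.1 hx hxh hs ht) (fun t ht => ?_)
    (x := 0) (y := 1) (by simp) (by simp)
  · simpa [taylorPart, listDeriv] using key
  · rw [Real.norm_eq_abs, taylorPart]
    refine (Finset.abs_sum_le_sum_abs _ _).trans ?_
    have := sum_prod_abs h 1
    rw [pow_one] at this
    rw [← this, Finset.mul_sum]
    refine Finset.sum_le_sum fun σ _ => ?_
    rw [abs_mul, mul_comm]
    exact mul_le_mul_of_nonneg_right (abs_listDeriv_le hf (by simpa using hs) (hmaps t ht))
      (abs_nonneg _)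

end HolderCube

/-! ### Good points, rounding, and the approximation on good points -/

section

open scoped Nat

open ReLUCalculus HolderCube

/-- A real number whose clamped multiple by `P` is not close to the next integer. -/
def CellGood (P : ℕ) (t : ℝ) : Prop :=
  ∃ k : ℕ, k < P ∧ (k : ℝ) ≤ P * clamp (1 - 1 / (4 * P)) t ∧
    P * clamp (1 - 1 / (4 * P)) t ≤ k + 1 - 1 / 4

lemma mul_clamp {P : ℕ} (hP : 0 < P) (t : ℝ) :
    P * clamp (1 - 1 / (4 * P)) t = max 0 (min (P * t) (P - 1 / 4)) := by
  have hP' : (0 : ℝ) < P := by exact_mod_cast hP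
  rw [clamp, mul_max_of_nonneg _ _ hP'.le, mul_min_of_nonneg _ _ hP'.le, mul_zero]
  congr 2
  field_simp

lemma cellGood_of_fract_le {P : ℕ} (hP : 0 < P) {t : ℝ} (h : Int.fract (P * t) ≤ 3 / 4) :
    CellGood P t := by
  have hP1 : (1 : ℝ) ≤ P := by exact_mod_cast hP
  unfold CellGood
  rw [mul_clamp hP]
  rcases lt_or_ge (P * t) 0 with h0 | h0
  · refine ⟨0, hP, ?_⟩
    rw [max_eq_left ((min_le_left _ _).trans h0.le)]
    norm_num
  rcases lt_or_ge ((P : ℝ) - 1 / 4) (P * t) with h1 | h1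
  · refine ⟨P - 1, by omega, ?_⟩
    rw [min_eq_right h1.le, max_eq_right (by linarith), Nat.cast_sub hP]
    constructor <;> push_cast <;> linarith
  · have hf := Int.floor_nonneg.2 h0
    have h2 := Int.floor_add_fract ((P : ℝ) * t)
    have h3 := Int.fract_nonneg ((P : ℝ) * t)
    obtain ⟨k, hk⟩ := Int.eq_ofNat_of_zero_le hf
    rw [hk] at h2
    push_cast at h2
    refine ⟨k, ?_, ?_⟩
    · have : (k : ℝ) < P := by linarith
      exact_mod_cast this
    · rw [min_eq_left h1, max_eq_right h0]
      constructor <;> linarith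

/-- Failure forces the fractional part of `P * t` into `(3/4, 1)`, an open arc of length `1/4`; of
three points spaced by `1/4` at most one lies in it. -/
lemma cellGood_two_of_three {P : ℕ} (hP : 0 < P) (t : ℝ) :
    (CellGood P (t + -(1 / (4 * P))) ∧ CellGood P t) ∨
      (CellGood P t ∧ CellGood P (t + 1 / (4 * P))) ∨
      (CellGood P (t + -(1 / (4 * P))) ∧ CellGood P (t + 1 / (4 * P))) := by
  have hP' : (0 : ℝ) < P := by exact_mod_cast hP
  have h1 : (P : ℝ) * (t + -(1 / (4 * P))) = P * t - 1 / 4 := by field_simp; ring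
  have h2 : (P : ℝ) * (t + 1 / (4 * P)) = P * t + 1 / 4 := by field_simp
  have key : ∀ (u : ℝ) (z : ℤ), (z : ℝ) ≤ P * u → P * u ≤ z + 3 / 4 → CellGood P u := by
    intro u z hz1 hz2
    refine cellGood_of_fract_le hP ?_
    have : ⌊(P : ℝ) * u⌋ = z := Int.floor_eq_iff.2 ⟨hz1, by linarith⟩
    rw [Int.fract, this]
    linarith
  have hf := Int.floor_add_fract ((P : ℝ) * t)
  have hf0 := Int.fract_nonneg ((P : ℝ) * t)
  have hf1 := Int.fract_lt_one ((P : ℝ) * t)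
  set z := ⌊(P : ℝ) * t⌋
  set θ := Int.fract ((P : ℝ) * t)
  rcases le_or_gt θ (1 / 2) with h | h
  · exact Or.inr (Or.inl ⟨key _ z (by linarith) (by linarith),
      key _ z (by rw [h2]; linarith) (by rw [h2]; linarith)⟩)
  rcases le_or_gt θ (3 / 4) with h' | h'
  · exact Or.inl ⟨key _ z (by rw [h1]; linarith) (by rw [h1]; linarith),
      key _ z (by linarith) (by linarith)⟩
  · exact Or.inr (Or.inr ⟨key _ z (by rw [h1]; linarith) (by rw [h1]; linarith),
      key _ (z + 1) (by rw [h2]; push_cast; linarith) (by rw [h2]; push_cast; linarith)⟩)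

/-- Greedy binary expansion by doubling. The range conditions on `c` stand inside the existential,
so that the bits can be chosen as a function of every real number. -/
lemma exists_bits (T : ℕ) : ∀ c : ℝ, ∃ b : ℕ → ℕ, (∀ t, b t ≤ 1) ∧ (0 ≤ c → c ≤ 1 →
    |c - ∑ t ∈ Finset.range T, (b t : ℝ) / 2 ^ (t + 1)| ≤ 1 / 2 ^ T) := by
  induction T with
  | zero =>
    intro c
    refine ⟨fun _ => 0, fun _ => by norm_num, fun h0 h1 => ?_⟩
    simp only [Finset.range_zero, Finset.sum_empty, sub_zero, pow_zero, div_one]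
    rwa [abs_of_nonneg h0]
  | succ T ih =>
    intro c
    obtain ⟨b₀, hb₀, h⟩ : ∃ b₀ : ℕ, b₀ ≤ 1 ∧ (0 ≤ c → c ≤ 1 → 0 ≤ 2 * c - b₀ ∧ 2 * c - b₀ ≤ 1) := by
      rcases le_total c (1 / 2) with h | h
      · exact ⟨0, by norm_num, fun h0 h1 => by constructor <;> push_cast <;> linarith⟩
      · exact ⟨1, le_rfl, fun h0 h1 => by constructor <;> push_cast <;> linarith⟩
    obtain ⟨b, hb, hc⟩ := ih (2 * c - b₀)
    refine ⟨fun t => Nat.casesOn t b₀ b, fun t => ?_, fun h0 h1 => ?_⟩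
    · cases t with
      | zero => exact hb₀
      | succ t => exact hb t
    · have := hc (h h0 h1).1 (h h0 h1).2
      rw [Finset.sum_range_succ']
      have e : ∑ t ∈ Finset.range T, (b t : ℝ) / 2 ^ (t + 1 + 1) =
          (∑ t ∈ Finset.range T, (b t : ℝ) / 2 ^ (t + 1)) / 2 := by
        rw [Finset.sum_div]
        refine Finset.sum_congr rfl fun t _ => ?_
        rw [pow_succ _ (t + 1)]
        field_simp
      have e2 : (1 : ℝ) / 2 ^ (T + 1) = 1 / 2 ^ T / 2 := by rw [pow_succ]; field_simp
      simp only [e, e2]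
      rw [abs_le] at this ⊢
      simp only [zero_add, pow_one]
      change -(1 / 2 ^ T / 2) ≤ c - (_ + (b₀ : ℝ) / 2) ∧ c - (_ + (b₀ : ℝ) / 2) ≤ 1 / 2 ^ T / 2
      constructor <;> linarith [this.1, this.2]

lemma exists_decode {d K : ℕ} (hK : 0 < K) : ∃ dec : ℕ → Fin d → ℕ, (∀ j i, dec j i < K) ∧
    ∀ k : Fin d → ℕ, (∀ i, k i < K) → dec (∑ i, k i * K ^ (i : ℕ)) = k := by
  refine ⟨fun j i => if h : j < K ^ d then finFunctionFinEquiv.symm ⟨j, h⟩ i else 0,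
    fun j i => ?_, fun k hk => ?_⟩
  · dsimp only
    split_ifs
    · exact Fin.is_lt _
    · exact hK
  · set k' : Fin d → Fin K := fun i => ⟨k i, hk i⟩
    have h1 : (∑ i, k i * K ^ (i : ℕ)) = (finFunctionFinEquiv k' : ℕ) := rfl
    ext i
    dsimp only
    rw [dif_pos (by rw [h1]; exact Fin.is_lt _)]
    simp only [h1, Fin.eta, Equiv.symm_apply_apply, k']

lemma abs_clamp_sub_le {a t x η : ℝ} (ha : 0 ≤ a) (ha1 : a ≤ 1) (hx0 : 0 ≤ x) (hx1 : x ≤ 1)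
    (h : |t - x| ≤ η) : |clamp a t - x| ≤ η + (1 - a) := by
  unfold clamp
  rw [abs_le] at *
  rcases le_total t a with h1 | h1
  · rw [min_eq_left h1]
    rcases le_total 0 t with h2 | h2
    · rw [max_eq_right h2]; constructor <;> linarith
    · rw [max_eq_left h2]; constructor <;> linarith
  · rw [min_eq_right h1, max_eq_right ha]; constructor <;> linarith

section approximation

variable {d s : ℕ} {r B₀ : ℝ} {f : EuclideanSpace ℝ (Fin d) → ℝ}

/-- The value produced by the network from exact grid data is close to the function. -/
lemma abs_sub_quantized_taylor_le (hB : 0 < B₀) (hr : 0 < r) (hf : f ∈ holderClass d s r B₀)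
    {c h : EuclideanSpace ℝ (Fin d)} (hc : c ∈ unitCube d) (hch : c + h ∈ unitCube d) {K : ℕ}
    (hK : 0 < K) (hh0 : ∀ i, 0 ≤ h i) (hhK : ∀ i, h i ≤ 1 / K) {τ : ℝ}
    {v : ∀ k : ℕ, (Fin k → Fin d) → ℝ}
    (hv : ∀ k ≤ s, ∀ σ : Fin k → Fin d, |(listDeriv (List.ofFn σ) f c / B₀ + 1) / 2 - v k σ| ≤ τ) :
    |f (c + h) - ∑ k ∈ Finset.range (s + 1), ∑ σ : Fin k → Fin d,
        (B₀ / k !) * ((2 * v k σ - 1) * ∏ i, h (σ i))| ≤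
      B₀ * ((d : ℝ) / K) ^ s * (√d / K) ^ r / s ! +
        (∑ k ∈ Finset.range (s + 1), (d : ℝ) ^ k) * (2 * B₀ * τ) := by
  have hK' : (1 : ℝ) ≤ K := by exact_mod_cast hK
  have hsum : ∑ i, |h i| ≤ d / K := by
    calc ∑ i, |h i| ≤ ∑ _i : Fin d, (1 / K : ℝ) :=
          Finset.sum_le_sum fun i _ => by rw [abs_of_nonneg (hh0 i)]; exact hhK i
      _ = d / K := by simp [div_eq_mul_inv]
  have hnorm : ‖h‖ ≤ √d / K := by
    rw [EuclideanSpace.norm_eq]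
    calc √(∑ i, ‖h i‖ ^ 2) ≤ √(∑ _i : Fin d, (1 / K : ℝ) ^ 2) := by
          refine Real.sqrt_le_sqrt (Finset.sum_le_sum fun i _ => ?_)
          rw [Real.norm_eq_abs, abs_of_nonneg (hh0 i)]
          have := hh0 i
          have := hhK i
          gcongr
      _ = √d / K := by
          rw [Finset.sum_const, Finset.card_univ, Fintype.card_fin, nsmul_eq_mul,
            Real.sqrt_mul (by positivity), Real.sqrt_sq (by positivity)]
          ring
  have hT := abs_sub_taylor_sum_le hB.le hr.le hf hc hch
  have hT' : B₀ * (∑ i, |h i|) ^ s * ‖h‖ ^ r / s ! ≤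
      B₀ * ((d : ℝ) / K) ^ s * (√d / K) ^ r / s ! := by
    gcongr
  have hQ : |∑ k ∈ Finset.range (s + 1), taylorPart f c h k / (k ! : ℝ) -
      ∑ k ∈ Finset.range (s + 1), ∑ σ : Fin k → Fin d,
        (B₀ / k !) * ((2 * v k σ - 1) * ∏ i, h (σ i))| ≤
      (∑ k ∈ Finset.range (s + 1), (d : ℝ) ^ k) * (2 * B₀ * τ) := by
    rw [← Finset.sum_sub_distrib, Finset.sum_mul]
    refine (Finset.abs_sum_le_sum_abs _ _).trans (Finset.sum_le_sum fun k hk => ?_)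
    rw [taylorPart, Finset.sum_div, ← Finset.sum_sub_distrib]
    refine (Finset.abs_sum_le_sum_abs _ _).trans ?_
    have hcard : (d : ℝ) ^ k * (2 * B₀ * τ) = ∑ _σ : Fin k → Fin d, 2 * B₀ * τ := by
      simp
    rw [hcard]
    refine Finset.sum_le_sum fun σ _ => ?_
    have h1 := hv k (Nat.lt_succ_iff.1 (Finset.mem_range.1 hk)) σ
    have h2 : (∏ i, h (σ i)) * listDeriv (List.ofFn σ) f c / (k ! : ℝ) -
        (B₀ / k !) * ((2 * v k σ - 1) * ∏ i, h (σ i)) =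
        2 * B₀ * ((listDeriv (List.ofFn σ) f c / B₀ + 1) / 2 - v k σ) * ((∏ i, h (σ i)) / k !) := by
      field_simp
      ring
    rw [h2, abs_mul, abs_mul, abs_of_pos (by positivity : 0 < 2 * B₀)]
    have h3 : 0 ≤ ∏ i, h (σ i) := Finset.prod_nonneg fun i _ => hh0 _
    have h4 : ∏ i, h (σ i) ≤ 1 := Finset.prod_le_one (fun i _ => hh0 _) fun i _ =>
      (hhK _).trans ((div_le_one (by positivity)).2 hK')
    have h5 : |(∏ i, h (σ i)) / (k ! : ℝ)| ≤ 1 := by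
      rw [abs_of_nonneg (by positivity), div_le_one (by positivity)]
      exact h4.trans (by exact_mod_cast Nat.factorial_pos k)
    calc 2 * B₀ * |(listDeriv (List.ofFn σ) f c / B₀ + 1) / 2 - v k σ| *
          |(∏ i, h (σ i)) / (k ! : ℝ)|
        ≤ 2 * B₀ * |(listDeriv (List.ofFn σ) f c / B₀ + 1) / 2 - v k σ| * 1 := by gcongr
      _ ≤ 2 * B₀ * τ := by rw [mul_one]; gcongr
  have := abs_sub_le (f (c + h)) (∑ k ∈ Finset.range (s + 1), taylorPart f c h k / k !)
    (∑ k ∈ Finset.range (s + 1), ∑ σ : Fin k → Fin d,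
        (B₀ / k !) * ((2 * v k σ - 1) * ∏ i, h (σ i)))
  linarith

/-- The approximation outside the exceptional set. -/
lemma exists_reach_approx (hB : 0 < B₀) (hr : 0 < r) (hf : f ∈ holderClass d s r B₀)
    {A B R l L K n e W D : ℕ} (hR : 0 < R) (hA : 0 < A) (hB' : 0 < B) (hK : 0 < K)
    (hBR : B ≤ R ^ l) (hKR : K ≤ R ^ l) (hKd : K ^ d ≤ A * (A * B ^ 2))
    (hW₀ : 2 ≤ W) (hW₁ : d * (2 * R + 2) ≤ W)
    (hW₂ : 2 * R + d + 4 ≤ W) (hW₃ : 2 * R + 3 * A + 3 ≤ W) (hW₄ : n * (3 * A + 11) + 1 ≤ W)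
    (hD : ∀ k ≤ s, 1 + l + 2 * L * k + (2 + l + (2 * B + 2 * (B * e))) ≤ D) {Ω : ℝ}
    (hΩ : ∀ x ∈ unitCube d, ∀ y ∈ unitCube d,
      (∀ i, |x i - y i| ≤ 2 / (K * R ^ L : ℕ)) → |f x - f y| ≤ Ω) :
    ∃ g : (Fin d → ℝ) → ℝ, Reach (coords d) ((∑ k ∈ Finset.range (s + 1), d ^ k) * W) D {g} ∧
      ∀ x : Fin d → ℝ, WithLp.toLp 2 x ∈ unitCube d → ∀ y : Fin d → ℝ,
        (∀ i, |y i - x i| ≤ 1 / (4 * (K * R ^ L : ℕ)) ∧ CellGood (K * R ^ L) (y i)) →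
        |g y - f (WithLp.toLp 2 x)| ≤ B₀ * ((d : ℝ) / K) ^ s * (√d / K) ^ r / s ! +
          (∑ k ∈ Finset.range (s + 1), (d : ℝ) ^ k) * (2 * B₀ * (1 / 2 ^ (n * e))) + Ω := by
  classical
  set P : ℕ := K * R ^ L with hP_def
  have hT : 0 < R ^ L := pow_pos hR L
  have hP : 0 < P := Nat.mul_pos hK hT
  have hP' : (1 : ℝ) ≤ P := by exact_mod_cast hP
  have hK' : (0 : ℝ) < K := by exact_mod_cast hK
  have hT' : (0 : ℝ) < (R : ℝ) ^ L := by exact_mod_cast hT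
  set c₀ : ℝ := 1 - 1 / (4 * P) with hc₀
  have hinv : (1 : ℝ) / (4 * P) ≤ 1 / 4 := by
    rw [div_le_div_iff₀ (by positivity) (by norm_num)]
    linarith
  have hinv0 : (0 : ℝ) ≤ 1 / (4 * P) := by positivity
  have hc₀0 : 0 ≤ c₀ := by linarith
  obtain ⟨dec, hdec, hdec'⟩ := exists_decode (d := d) hK
  set corner : ℕ → EuclideanSpace ℝ (Fin d) := fun j => WithLp.toLp 2 fun i => (dec j i : ℝ) / K
    with hcorner
  have hcorner_mem : ∀ j, corner j ∈ unitCube d := fun j i => by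
    refine ⟨by simp only [hcorner]; positivity, ?_⟩
    simp only [hcorner]
    rw [div_le_one hK']
    exact_mod_cast (hdec j i).le
  choose bits hbits hbits' using exists_bits (n * e)
  -- Derivatives lie in `[-B₀, B₀]`; they are moved to `[0, 1]` before rounding, and `2 * v - 1`
  -- moves them back.
  set bit : ∀ k : ℕ, (Fin k → Fin d) → ℕ → ℕ → ℕ := fun k σ j =>
    bits ((listDeriv (List.ofFn σ) f (corner j) / B₀ + 1) / 2)
  -- On good points the rounded coordinates `p` are genuine functions with a uniform gap `1 / 4`.
  -- The network is built over this subtype and extended to the whole space by `Reach.lift`.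
  set X := {y : Fin d → ℝ // ∀ i, CellGood P (y i)}
  have hX : ∀ (i : Fin d) (q : X), CellGood P (q.1 i) := fun i q => q.2 i
  choose p hp hp1 hp2 using hX
  set z : ∀ k : ℕ, (Fin k → Fin d) → X → ℝ := fun k σ q =>
    ∏ i, (((p (σ i) q % R ^ L : ℕ) : ℝ) / R ^ L) with hz
  set j : X → ℕ := fun q => ∑ i, p i q / R ^ L * K ^ (i : ℕ) with hj
  set v : ∀ k : ℕ, (Fin k → Fin d) → X → ℝ := fun k σ q =>
    ∑ t ∈ Finset.range (n * e), (bit k σ (j q) t : ℝ) / 2 ^ (t + 1) with hv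
  have hPc : (P : ℝ) = K * R ^ L := by simp [hP_def]
  have hp1' : ∀ i q, (p i q : ℝ) ≤ K * R ^ L * clamp c₀ (q.1 i) := fun i q => by
    rw [← hPc]; exact hp1 i q
  have hp2' : ∀ i q, K * R ^ L * clamp c₀ (q.1 i) ≤ p i q + 1 - 1 / 4 := fun i q => by
    rw [← hPc]; exact hp2 i q
  have hz0 : ∀ k σ q, 0 ≤ z k σ q := fun k σ q => Finset.prod_nonneg fun i _ => by positivity
  have hv0 : ∀ k σ q, 0 ≤ v k σ q := fun k σ q => sum_bits_nonneg _ _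
  set S : Set (X → ℝ) := Set.range fun i (q : X) => q.1 i
  have hbranch : ∀ k ≤ s, ∀ σ : Fin k → Fin d,
      Reach S W D {z k σ, fun q => z k σ q * v k σ q} := by
    intro k hk σ
    refine (reach_branch (x := fun i (q : X) => q.1 i) (p := p) (c := c₀) (δ := 1 / 4)
      (bit := bit k σ) (n := n) (e := e) (L := L) (K := K) hR hA hB' hc₀0 (by norm_num) hBR hKR hKd
      hp hp1' hp2'
      (fun i t => hbits _ _) σ hW₁ hW₂ hW₃ hW₄).pad ?_ ?_ (hD k hk)
    · exact encard_insert_le_of_le _ (encard_singleton_le _ le_rfl) hW₀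
    · rintro _ (rfl | rfl) q
      · exact hz0 k σ q
      · exact mul_nonneg (hz0 k σ q) (hv0 k σ q)
  set I : Finset (Σ k : ℕ, (Fin k → Fin d)) :=
    (Finset.range (s + 1)).sigma fun k => (Finset.univ : Finset (Fin k → Fin d)) with hI
  have hIcard : I.card = ∑ k ∈ Finset.range (s + 1), d ^ k := by
    simp [hI, Finset.card_sigma]
  have hall := Reach.iUnion I (S := S) (W := W) (D := D)
    (T := fun a => {z a.1 a.2, fun q => z a.1 a.2 q * v a.1 a.2 q}) fun a ha =>
      hbranch a.1 (Nat.lt_succ_iff.1 (Finset.mem_range.1 (Finset.mem_sigma.1 ha).1)) a.2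
  rw [hIcard] at hall
  -- `K ^ (-k)` converts offsets measured in cells into lengths. Undoing the recentring needs the
  -- bare monomial `z`, which is why every branch outputs it too.
  set g₀ : X → ℝ := fun q => ∑ a ∈ I,
    (B₀ / (a.1)! / K ^ a.1) * (2 * (z a.1 a.2 q * v a.1 a.2 q) - z a.1 a.2 q) with hg₀
  have hreach : Reach S ((∑ k ∈ Finset.range (s + 1), d ^ k) * W) D {g₀} := by
    refine hall.post ?_
    rintro _ rfl
    refine aff_sum _ fun a ha => aff_mul _ (aff_sub (aff_mul _ (aff_mem ?_)) (aff_mem ?_))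
    · exact Set.mem_biUnion ha (by simp)
    · exact Set.mem_biUnion ha (by simp)
  have hS : S = (fun g : (Fin d → ℝ) → ℝ => g ∘ (Subtype.val : X → Fin d → ℝ)) '' coords d := by
    rw [coords, ← Set.range_comp]
    rfl
  rw [hS] at hreach
  obtain ⟨T', hT'r, hT'l⟩ := hreach.lift
  obtain ⟨g, hgT, hg⟩ := hT'l g₀ rfl
  refine ⟨g, hT'r.post (by rintro _ rfl; exact aff_mem hgT), fun x hx y hy => ?_⟩
  set q : X := ⟨y, fun i => (hy i).2⟩
  have hgy : g y = g₀ q := congrFun hg q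
  set c := corner (j q)
  set h : EuclideanSpace ℝ (Fin d) :=
    WithLp.toLp 2 fun i => ((p i q % R ^ L : ℕ) : ℝ) / R ^ L / K with hh
  have hdj : dec (j q) = fun i => p i q / R ^ L :=
    hdec' (fun i => p i q / R ^ L) fun i => (Nat.div_lt_iff_lt_mul hT).2 (hp i q)
  have hmod : ∀ i, ((p i q % R ^ L : ℕ) : ℝ) / R ^ L ≤ 1 := fun i => by
    rw [div_le_one hT']
    exact_mod_cast (Nat.mod_lt _ hT).le
  have hch : ∀ i, (c + h) i = (p i q : ℝ) / P := by
    intro i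
    have e1 : (p i q : ℝ) = R ^ L * (p i q / R ^ L : ℕ) + (p i q % R ^ L : ℕ) := by
      exact_mod_cast (Nat.div_add_mod (p i q) (R ^ L)).symm
    simp only [c, hcorner, hh, PiLp.add_apply, hdj, hP_def]
    rw [e1]
    push_cast
    field_simp
  have hch_mem : c + h ∈ unitCube d := fun i => by
    rw [hch, Set.mem_Icc, div_le_one (by positivity)]
    exact ⟨by positivity, by exact_mod_cast (hp i q).le⟩
  have hmain := abs_sub_quantized_taylor_le hB hr hf (hcorner_mem (j q)) hch_mem hK
    (fun i => by simp only [hh]; positivity)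
    (fun i => by simp only [hh]; gcongr; exact hmod i) (τ := 1 / 2 ^ (n * e))
    (v := fun k σ => v k σ q) (fun k hk σ => by
      have hb := abs_listDeriv_le hf (l := List.ofFn σ) (by simpa using hk) (hcorner_mem (j q))
      rw [abs_le] at hb
      refine hbits' _ ?_ ?_
      · have : -1 ≤ listDeriv (List.ofFn σ) f (corner (j q)) / B₀ := by
          rw [le_div_iff₀ hB]; linarith [hb.1]
        linarith
      · have : listDeriv (List.ofFn σ) f (corner (j q)) / B₀ ≤ 1 := by
          rw [div_le_one hB]; exact hb.2
        linarith)
  have hgeq : g₀ q = ∑ k ∈ Finset.range (s + 1), ∑ σ : Fin k → Fin d,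
      (B₀ / k !) * ((2 * v k σ q - 1) * ∏ i, h (σ i)) := by
    simp only [hg₀, hI]
    rw [Finset.sum_sigma]
    refine Finset.sum_congr rfl fun k _ => Finset.sum_congr rfl fun σ _ => ?_
    have : ∏ i, h (σ i) = z k σ q / K ^ k := by
      simp only [hh, hz]
      rw [Finset.prod_div_distrib]
      simp
    rw [this]
    field_simp
  -- The displacement is at most `1/(4P)` from the shift, `1/(4P)` from clamping and `3/(4P)` from
  -- rounding down, in total below `2/P`.
  have hpos : |f (WithLp.toLp 2 x) - f (c + h)| ≤ Ω := by
    refine hΩ _ hx _ hch_mem fun i => ?_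
    rw [hch]
    have h1 := abs_clamp_sub_le hc₀0 (by linarith) (hx i).1 (hx i).2 (hy i).1
    have h2 := hp1 i q
    have h3 := hp2 i q
    rw [← hc₀] at h2 h3
    have hPp : (0 : ℝ) < P := by linarith
    have h4 : (p i q : ℝ) / P ≤ clamp c₀ (y i) := by
      rw [div_le_iff₀ hPp]; linarith
    have h5 : clamp c₀ (y i) ≤ (p i q : ℝ) / P + 3 / 4 * (1 / P) := by
      have : (p i q : ℝ) / P + 3 / 4 * (1 / P) = (p i q + 3 / 4) / P := by ring
      rw [this, le_div_iff₀ hPp]; linarith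
    have e1 : (1 : ℝ) / (4 * P) = 1 / 4 * (1 / P) := by field_simp
    have e2 : (2 : ℝ) / P = 2 * (1 / P) := by ring
    have e3 : (0 : ℝ) ≤ 1 / P := by positivity
    rw [e2]
    simp only [hc₀, e1] at h1 h4 h5
    rw [abs_le] at h1 ⊢
    constructor <;> linarith [h1.1, h1.2]
  rw [hgy, hgeq, abs_sub_comm]
  refine (abs_sub_le _ (f (c + h)) _).trans ?_
  linarith

end approximation

/-! ### Parameters and numerical bounds -/

lemma exists_ceil_logb_eq {N : ℕ} (hN : 1 ≤ N) :
    ∃ ν : ℕ, ⌈Real.logb 2 (8 * (N : ℝ))⌉₊ = ν + 3 ∧ N ≤ 2 ^ ν ∧ 2 ^ ν ≤ 2 * N := by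
  refine ⟨Nat.clog 2 N, ?_, Nat.le_pow_clog (by norm_num) N, ?_⟩
  · have h1 : (8 * (N : ℝ)) = ((N * 2 * 2 * 2 : ℕ) : ℝ) := by push_cast; ring
    have h2 := Real.natCeil_logb_natCast 2 (N * 2 * 2 * 2)
    rw [h1]
    push_cast at h2 ⊢
    have h3 : ∀ n : ℕ, 1 ≤ n → Nat.clog 2 (n * 2) = Nat.clog 2 n + 1 := fun n hn => by
      rw [Nat.clog_of_two_le (by norm_num) (by omega), show (n * 2 + 2 - 1) / 2 = n by omega]
    rw [h2, h3 _ (by omega), h3 _ (by omega), h3 _ hN]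
  · rcases Nat.lt_or_ge 1 N with h | h
    · have h1 := Nat.pow_pred_clog_lt_self (b := 2) (by norm_num) h
      have h2 : 0 < Nat.clog 2 N := Nat.clog_pos (by norm_num) h
      obtain ⟨m, hm⟩ := Nat.exists_eq_add_of_lt h2
      rw [hm] at h1 ⊢
      simp only [zero_add, Nat.pred_eq_sub_one, Nat.add_sub_cancel] at h1 ⊢
      rw [pow_succ]
      omega
    · have : N = 1 := by omega
      subst this
      simp

/-- `κ` is `log₂ Q` divided by `d`, rounded down. The possible factor `2` in the mesh costs `2 ^ β`
in the Taylor error. -/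
lemma exists_dyadic_cells {d Q : ℕ} (hd : 1 ≤ d) (hQ : 1 ≤ Q) :
    ∃ κ : ℕ, (2 ^ κ) ^ d ≤ Q ∧ Q ≤ (2 * 2 ^ κ) ^ d := by
  refine ⟨Nat.log 2 Q / d, ?_, ?_⟩
  · rw [← pow_mul]
    exact (Nat.pow_le_pow_right (by norm_num) (Nat.div_mul_le_self _ _)).trans
      (Nat.pow_log_le_self 2 (by omega))
  · rw [← pow_succ', ← pow_mul]
    refine (Nat.lt_pow_succ_log_self (by norm_num) Q).le.trans
      (Nat.pow_le_pow_right (by norm_num) ?_)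
    have := Nat.lt_div_mul_add (a := Nat.log 2 Q) (b := d) (by omega)
    rw [add_mul, one_mul]
    omega

/-- Lets the `1 / s !` of Taylor's formula absorb the loss `2 ^ β ≤ 2 ^ (s + 1)` of the dyadic mesh,
leaving the constant `4` in `taylor_term_le`. -/
lemma two_pow_le_two_mul_factorial (s : ℕ) : 2 ^ s ≤ 2 * s ! := by
  induction s with
  | zero => norm_num
  | succ s ih =>
    rcases Nat.eq_zero_or_pos s with rfl | hs
    · norm_num
    · rw [pow_succ, Nat.factorial_succ]
      nlinarith

lemma inv_rpow_le {d : ℕ} (hd : 1 ≤ d) {Z K β : ℝ} (hZ : 1 ≤ Z) (hK : 0 < K) (hβ : 0 ≤ β)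
    (h : Z ^ 2 ≤ (2 * K) ^ d) : 1 / K ^ β ≤ 2 ^ β * Z ^ (-2 * β / (d : ℝ)) := by
  have hd' : (0 : ℝ) < d := by exact_mod_cast hd
  have hZ0 : 0 < Z := by linarith
  have h1 : Z ^ (2 / (d : ℝ)) ≤ 2 * K := by
    have := Real.rpow_le_rpow (by positivity) h (by positivity : (0 : ℝ) ≤ 1 / d)
    rw [← Real.rpow_natCast, ← Real.rpow_natCast, ← Real.rpow_mul hZ0.le,
      ← Real.rpow_mul (by positivity), mul_one_div, mul_one_div, div_self hd'.ne',
      Real.rpow_one] at this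
    exact_mod_cast this
  have h2 : Z ^ (2 * β / (d : ℝ)) ≤ 2 ^ β * K ^ β := by
    rw [← Real.mul_rpow (by norm_num) hK.le]
    have := Real.rpow_le_rpow (by positivity) h1 hβ
    rwa [← Real.rpow_mul hZ0.le, show 2 / (d : ℝ) * β = 2 * β / d by ring] at this
  rw [show -2 * β / (d : ℝ) = -(2 * β / d) by ring, Real.rpow_neg hZ0.le, ← div_eq_mul_inv,
    div_le_div_iff₀ (by positivity) (by positivity), one_mul]
  exact h2

/-- Since `β / d ≤ s + 1`, a precision of `Z ^ (-2 * (s + 1))` is always enough. Precision costs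
only logarithmically many digits, so nothing sharper is needed. -/
lemma inv_le_rpow {d s : ℕ} (hd : 1 ≤ d) {Z Q β : ℝ} (hZ : 1 ≤ Z) (hβ0 : 0 ≤ β) (hβ : β ≤ s + 1)
    (h : Z ^ (2 * (s + 1)) ≤ Q) : 1 / Q ≤ Z ^ (-2 * β / (d : ℝ)) := by
  have hd' : (1 : ℝ) ≤ d := by exact_mod_cast hd
  have hZ0 : 0 < Z := by linarith
  calc 1 / Q ≤ 1 / Z ^ (2 * (s + 1)) := one_div_le_one_div_of_le (by positivity) h
    _ = Z ^ (-(2 * ((s : ℝ) + 1))) := by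
        rw [Real.rpow_neg hZ0.le, one_div, ← Real.rpow_natCast]
        push_cast
        rfl
    _ ≤ _ := by
        refine Real.rpow_le_rpow_of_exponent_le hZ ?_
        have : β / d ≤ β := div_le_self hβ0 hd'
        rw [show -2 * β / (d : ℝ) = -(2 * (β / d)) by ring]
        linarith

section bounds

variable {d s : ℕ} {r B₀ β : ℝ} {f : EuclideanSpace ℝ (Fin d) → ℝ}

lemma pow_mul_sqrt_rpow_le (hd : 1 ≤ d) (hr1 : r ≤ 1) :
    (d : ℝ) ^ s * √d ^ r ≤ (d : ℝ) ^ ((s : ℝ) + max β 1 / 2) := by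
  have hd' : (1 : ℝ) ≤ d := by exact_mod_cast hd
  have hd0 : (0 : ℝ) < d := by linarith
  rw [Real.sqrt_eq_rpow, ← Real.rpow_mul hd0.le, ← Real.rpow_natCast, ← Real.rpow_add hd0]
  refine Real.rpow_le_rpow_of_exponent_le hd' ?_
  have := le_max_right β 1
  linarith

/-- Rounding error of the point. For `s = 0` it is governed by `P ^ (-r)` with `P ≥ Z ^ 2` and `r =
β`; for `s ≥ 1` by the Lipschitz bound and `inv_le_rpow`. -/
lemma abs_sub_le_of_close (hd : 1 ≤ d) (hr0 : 0 < r) (hr1 : r ≤ 1) (hβ : β = s + r)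
    (hB₀ : 0 < B₀) (hf : f ∈ holderClass d s r B₀) {Z P : ℝ} (hZ : 1 ≤ Z)
    (hP : Z ^ (2 * (s + 1)) ≤ P) {x y : EuclideanSpace ℝ (Fin d)} (hx : x ∈ unitCube d)
    (hy : y ∈ unitCube d) (hxy : ∀ i, |x i - y i| ≤ 2 / P) :
    |f x - f y| ≤ 2 * (B₀ * (d : ℝ) ^ ((s : ℝ) + max β 1 / 2) * Z ^ (-2 * β / (d : ℝ))) := by
  have hd' : (1 : ℝ) ≤ d := by exact_mod_cast hd
  have hd0 : (0 : ℝ) < d := by linarith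
  have hZ0 : 0 < Z := by linarith
  have hP1 : 1 ≤ P := (one_le_pow₀ hZ).trans hP
  have hxh : y + (x - y) = x := by abel
  rcases Nat.eq_zero_or_pos s with rfl | hs
  · have h1 : |f x - f y| ≤ B₀ * ‖x - y‖ ^ r := by
      simpa [listDeriv] using abs_listDeriv_sub_le hf (l := []) rfl hx hy
    have h2 : ‖x - y‖ ≤ √d * (2 / P) := by
      rw [EuclideanSpace.norm_eq]
      calc √(∑ i, ‖(x - y) i‖ ^ 2) ≤ √(∑ _i : Fin d, (2 / P : ℝ) ^ 2) := by
            refine Real.sqrt_le_sqrt (Finset.sum_le_sum fun i _ => ?_)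
            rw [Real.norm_eq_abs]
            have := hxy i
            rw [PiLp.sub_apply]
            gcongr
        _ = √d * (2 / P) := by
            rw [Finset.sum_const, Finset.card_univ, Fintype.card_fin, nsmul_eq_mul,
              Real.sqrt_mul (by positivity), Real.sqrt_sq (by positivity)]
    have h3 : ‖x - y‖ ^ r ≤ √d ^ r * (2 ^ r * (1 / P ^ r)) := by
      calc ‖x - y‖ ^ r ≤ (√d * (2 / P)) ^ r := by gcongr
        _ = _ := by
          rw [Real.mul_rpow (by positivity) (by positivity), Real.div_rpow (by norm_num)
            (by linarith)]
          ring
    have h4 : (2 : ℝ) ^ r ≤ 2 := by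
      calc (2 : ℝ) ^ r ≤ 2 ^ (1 : ℝ) := Real.rpow_le_rpow_of_exponent_le (by norm_num) hr1
        _ = 2 := Real.rpow_one 2
    have hβr : β = r := by simpa using hβ
    have h5 : 1 / P ^ r ≤ Z ^ (-2 * β / (d : ℝ)) := by
      have hP2 : Z ^ 2 ≤ P := by simpa using hP
      calc 1 / P ^ r ≤ 1 / (Z ^ 2) ^ r := by gcongr
        _ = Z ^ (-(2 * r)) := by
            rw [Real.rpow_neg hZ0.le, one_div, ← Real.rpow_natCast, ← Real.rpow_mul hZ0.le]
            norm_num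
        _ ≤ _ := by
            refine Real.rpow_le_rpow_of_exponent_le hZ ?_
            have : r / d ≤ r := div_le_self hr0.le hd'
            rw [hβr, show -2 * r / (d : ℝ) = -(2 * (r / d)) by ring]
            linarith
    have h6 := pow_mul_sqrt_rpow_le (s := 0) (β := β) hd hr1
    rw [pow_zero, one_mul] at h6
    calc |f x - f y| ≤ B₀ * ‖x - y‖ ^ r := h1
      _ ≤ B₀ * (√d ^ r * (2 ^ r * (1 / P ^ r))) := by gcongr
      _ ≤ B₀ * ((d : ℝ) ^ (((0 : ℕ) : ℝ) + max β 1 / 2) * (2 * Z ^ (-2 * β / (d : ℝ)))) := by gcongr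
      _ = _ := by ring
  · have h1 : |f x - f y| ≤ B₀ * ∑ i, |(x - y) i| := by
      have := abs_sub_le_of_one_le hf hs hy (h := x - y) (by rwa [hxh])
      rwa [hxh] at this
    have h2 : ∑ i, |(x - y) i| ≤ d * (2 * (1 / P)) := by
      calc ∑ i, |(x - y) i| ≤ ∑ _i : Fin d, (2 / P : ℝ) := Finset.sum_le_sum fun i _ => hxy i
        _ = _ := by
          rw [Finset.sum_const, Finset.card_univ, Fintype.card_fin, nsmul_eq_mul]
          ring
    have h3 : (d : ℝ) ≤ (d : ℝ) ^ ((s : ℝ) + max β 1 / 2) := by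
      calc (d : ℝ) = (d : ℝ) ^ (1 : ℝ) := (Real.rpow_one _).symm
        _ ≤ _ := by
          refine Real.rpow_le_rpow_of_exponent_le hd' ?_
          have : (1 : ℝ) ≤ s := by exact_mod_cast hs
          have := le_max_right β 1
          linarith
    have h4 : 1 / P ≤ Z ^ (-2 * β / (d : ℝ)) :=
      inv_le_rpow hd hZ (by rw [hβ]; positivity) (by rw [hβ]; linarith) hP
    calc |f x - f y| ≤ B₀ * ∑ i, |(x - y) i| := h1
      _ ≤ B₀ * (d * (2 * (1 / P))) := by gcongr
      _ ≤ B₀ * ((d : ℝ) ^ ((s : ℝ) + max β 1 / 2) * (2 * Z ^ (-2 * β / (d : ℝ)))) := by gcongr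
      _ = _ := by ring

lemma taylor_term_le (hd : 1 ≤ d) (hr0 : 0 < r) (hr1 : r ≤ 1) (hβ : β = s + r) (hB₀ : 0 < B₀)
    {Z K : ℝ} (hZ : 1 ≤ Z) (hK : 0 < K) (h : Z ^ 2 ≤ (2 * K) ^ d) :
    B₀ * ((d : ℝ) / K) ^ s * (√d / K) ^ r / s ! ≤
      4 * (B₀ * (d : ℝ) ^ ((s : ℝ) + max β 1 / 2) * Z ^ (-2 * β / (d : ℝ))) := by
  have hβ0 : 0 ≤ β := by rw [hβ]; positivity
  have hZ0 : 0 < Z := by linarith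
  have h1 := inv_rpow_le hd hZ hK hβ0 h
  have h2 := pow_mul_sqrt_rpow_le (s := s) (β := β) hd hr1
  have h3 : (2 : ℝ) ^ β ≤ 4 * s ! := by
    calc (2 : ℝ) ^ β ≤ 2 ^ ((s + 1 : ℕ) : ℝ) :=
          Real.rpow_le_rpow_of_exponent_le (by norm_num) (by rw [hβ]; push_cast; linarith)
      _ = 2 ^ s * 2 := by rw [Real.rpow_natCast, pow_succ]
      _ ≤ (2 * s !) * 2 := by
          gcongr
          exact_mod_cast two_pow_le_two_mul_factorial s
      _ = _ := by ring
  have h4 : B₀ * ((d : ℝ) / K) ^ s * (√d / K) ^ r / s ! =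
      B₀ * ((d : ℝ) ^ s * √d ^ r) * (1 / K ^ β) / s ! := by
    rw [div_pow, Real.div_rpow (by positivity) hK.le, hβ, Real.rpow_add hK, Real.rpow_natCast]
    field_simp
  have hs : (0 : ℝ) < s ! := by exact_mod_cast Nat.factorial_pos s
  rw [h4, div_le_iff₀ hs]
  calc B₀ * ((d : ℝ) ^ s * √d ^ r) * (1 / K ^ β)
      ≤ B₀ * (d : ℝ) ^ ((s : ℝ) + max β 1 / 2) * ((4 * s !) * Z ^ (-2 * β / (d : ℝ))) := by
        gcongr
        exact h1.trans (by gcongr)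
    _ = _ := by ring

lemma sum_pow_le (hd : 1 ≤ d) : ∑ k ∈ Finset.range (s + 1), d ^ k ≤ (s + 1) * d ^ s := by
  calc ∑ k ∈ Finset.range (s + 1), d ^ k ≤ ∑ _k ∈ Finset.range (s + 1), d ^ s :=
        Finset.sum_le_sum fun k hk =>
          Nat.pow_le_pow_right hd (Nat.lt_succ_iff.1 (Finset.mem_range.1 hk))
    _ = _ := by simp

lemma quantization_term_le (hd : 1 ≤ d) (hr0 : 0 < r) (hr1 : r ≤ 1) (hβ : β = s + r)
    (hB₀ : 0 < B₀) {Z Q : ℝ} (hZ : 1 ≤ Z) (hQ : Z ^ (2 * (s + 1)) ≤ Q) :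
    (∑ k ∈ Finset.range (s + 1), (d : ℝ) ^ k) * (2 * B₀ * (1 / Q)) ≤
      2 * ((s : ℝ) + 1) *
        (B₀ * (d : ℝ) ^ ((s : ℝ) + max β 1 / 2) * Z ^ (-2 * β / (d : ℝ))) := by
  have hd' : (1 : ℝ) ≤ d := by exact_mod_cast hd
  have hQ0 : 0 < Q := lt_of_lt_of_le (by positivity) hQ
  have h1 : ∑ k ∈ Finset.range (s + 1), (d : ℝ) ^ k ≤ (s + 1) * d ^ s := by
    exact_mod_cast sum_pow_le (s := s) hd
  have h2 : (d : ℝ) ^ s ≤ (d : ℝ) ^ ((s : ℝ) + max β 1 / 2) := by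
    rw [← Real.rpow_natCast]
    refine Real.rpow_le_rpow_of_exponent_le hd' ?_
    have := le_max_right β 1
    linarith
  have h3 : 1 / Q ≤ Z ^ (-2 * β / (d : ℝ)) :=
    inv_le_rpow hd hZ (by rw [hβ]; positivity) (by rw [hβ]; linarith) hQ
  calc (∑ k ∈ Finset.range (s + 1), (d : ℝ) ^ k) * (2 * B₀ * (1 / Q))
      ≤ ((s + 1) * (d : ℝ) ^ ((s : ℝ) + max β 1 / 2)) *
        (2 * B₀ * Z ^ (-2 * β / (d : ℝ))) := by
        gcongr
        exact h1.trans (by gcongr)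
    _ = _ := by ring

end bounds

/-- The summands are, in order: locating the cell, `k` exact multiplications, splitting the cell
number, scanning the rows, extracting the bits. -/
lemma depth_le {s k μ M B : ℕ} (hM : 1 ≤ M) (hk : k ≤ s) (hB : B ≤ 2 * M) :
    1 + 2 * (μ + 1) + 2 * (2 * (s + 1) * (μ + 1)) * k +
      (2 + 2 * (μ + 1) + (2 * B + 2 * (B * ((s + 1) * (μ + 3))))) ≤
      21 * (s + 1) ^ 2 * M * (μ + 3) := by
  have h1 : (s + 1) * (μ + 1) * k ≤ (s + 1) ^ 2 * M * (μ + 3) := by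
    calc (s + 1) * (μ + 1) * k ≤ (s + 1) * (μ + 3) * (s + 1) := by gcongr <;> omega
      _ = (s + 1) ^ 2 * 1 * (μ + 3) := by ring
      _ ≤ _ := by gcongr
  have h2 : B * ((s + 1) * (μ + 3)) ≤ 2 * ((s + 1) ^ 2 * M * (μ + 3)) := by
    calc B * ((s + 1) * (μ + 3)) ≤ 2 * M * ((s + 1) ^ 2 * (μ + 3)) := by
          gcongr
          nlinarith
      _ = _ := by ring
  have h3 : μ + 3 ≤ (s + 1) ^ 2 * M * (μ + 3) := by
    have : 1 ≤ (s + 1) ^ 2 * M := Nat.one_le_iff_ne_zero.2 (by positivity)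
    nlinarith
  have h4 : M * 3 ≤ (s + 1) ^ 2 * M * (μ + 3) := by
    calc M * 3 = 1 * M * 3 := by ring
      _ ≤ _ := by gcongr <;> [exact Nat.one_le_pow _ _ (by omega); omega]
  have e1 : 2 * (2 * (s + 1) * (μ + 1)) * k = 4 * ((s + 1) * (μ + 1) * k) := by ring
  have e2 : 21 * (s + 1) ^ 2 * M * (μ + 3) = 21 * ((s + 1) ^ 2 * M * (μ + 3)) := by ring
  rw [e1, e2]
  omega

lemma branch_width_le {d N ν : ℕ} (hd : 1 ≤ d) (hN : 1 ≤ N) (hν : 2 ^ ν ≤ 2 * N) :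
    2 ≤ 20 * d * N * (ν + 3) ∧ d * (2 * 2 ^ (ν + 1) + 2) ≤ 20 * d * N * (ν + 3) ∧
      2 * 2 ^ (ν + 1) + d + 4 ≤ 20 * d * N * (ν + 3) ∧
      2 * 2 ^ (ν + 1) + 3 * 2 ^ ν + 3 ≤ 20 * d * N * (ν + 3) ∧
      (ν + 3) * (3 * 2 ^ ν + 11) + 1 ≤ 20 * d * N * (ν + 3) := by
  have hdN : 1 ≤ d * N := Nat.one_le_iff_ne_zero.2 (by positivity)
  have h1 : N ≤ d * N := Nat.le_mul_of_pos_left N hd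
  have h2 : d ≤ d * N := Nat.le_mul_of_pos_right d hN
  have h3 : d * N * 3 ≤ d * N * (ν + 3) := by gcongr; omega
  have e : 20 * d * N * (ν + 3) = 20 * (d * N * (ν + 3)) := by ring
  rw [e, pow_succ]
  refine ⟨by omega, ?_, by omega, by omega, ?_⟩
  · calc d * (2 * (2 ^ ν * 2) + 2) ≤ d * (2 * (2 * N * 2) + 2 * N) := by gcongr; omega
      _ = 10 * (d * N) := by ring
      _ ≤ _ := by omega
  · have h4 : (ν + 3) * (3 * 2 ^ ν + 11) ≤ (ν + 3) * (17 * (d * N)) := by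
      gcongr
      omega
    have h5 : (ν + 3) * (17 * (d * N)) = 17 * (d * N * (ν + 3)) := by ring
    omega

lemma mul_pow_le_digits {N M ν μ : ℕ} (hN : N ≤ 2 ^ ν) (hM : M ≤ 2 ^ μ) :
    N * M ≤ (2 ^ (ν + 1)) ^ (μ + 1) := by
  calc N * M ≤ 2 ^ ν * 2 ^ μ := Nat.mul_le_mul hN hM
    _ = 2 ^ (ν + μ) := (pow_add _ _ _).symm
    _ ≤ 2 ^ ((ν + 1) * (μ + 1)) := Nat.pow_le_pow_right (by norm_num) (by nlinarith)
    _ = _ := pow_mul _ _ _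

end

/-! ### Choice of parameters and conclusion -/

theorem corollary3p2 (d : ℕ) (hd : 1 ≤ d) (β r B₀ : ℝ) (s : ℕ)
    (hr0 : 0 < r) (hr1 : r ≤ 1) (hβ : β = s + r) (hB₀ : 0 < B₀)
    (f : EuclideanSpace ℝ (Fin d) → ℝ) (hf : f ∈ holderClass d s r B₀)
    (M N : ℕ) (hM : 1 ≤ M) (hN : 1 ≤ N) :
    ∃ φ : ReLUNet 1 d,
      φ.width =
        38 * (s + 1) ^ 2 * 3 ^ d * d ^ (s + 1) * N * ⌈Real.logb 2 (8 * (N : ℝ))⌉₊ ∧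
      φ.depth = 21 * (s + 1) ^ 2 * M * ⌈Real.logb 2 (8 * (M : ℝ))⌉₊ + 2 * d ∧
      ∀ x ∈ unitCube d,
        |f x - φ.eval (fun i => x i) 0| ≤
          19 * B₀ * ((s : ℝ) + 1) ^ 2 * (d : ℝ) ^ ((s : ℝ) + (max β 1) / 2) *
            ((N : ℝ) * (M : ℝ)) ^ (-2 * β / (d : ℝ)) := by
  obtain ⟨ν, hν, hNν, hνN⟩ := exists_ceil_logb_eq hN
  obtain ⟨μ, hμ, hMμ, hμM⟩ := exists_ceil_logb_eq hM
  rw [hν, hμ]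
  have hNM : 1 ≤ N * M := Nat.mul_pos hN hM
  obtain ⟨κ, hκ1, hκ2⟩ := exists_dyadic_cells hd (Nat.one_le_pow 2 _ hNM)
  set Z : ℝ := (N : ℝ) * M with hZ_def
  have hZ : 1 ≤ Z := by rw [hZ_def]; exact_mod_cast hNM
  have hdig := mul_pow_le_digits hNν hMμ
  -- The exponent `ν + 1` keeps the base at least `2` when `N = 1`; likewise `μ + 1` digits leave at
  -- least one when `M = 1`.
  set R := 2 ^ (ν + 1) with hR_def
  have hR : 0 < R := by positivity
  have hRl : (N * M) ^ 2 ≤ R ^ (2 * (μ + 1)) := by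
    rw [mul_comm 2, pow_mul]
    exact Nat.pow_le_pow_left hdig 2
  have hRL : (N * M) ^ (2 * (s + 1)) ≤ R ^ (2 * (s + 1) * (μ + 1)) := by
    rw [mul_comm _ (μ + 1), pow_mul R]
    exact Nat.pow_le_pow_left hdig _
  have hK0 : 0 < 2 ^ κ := by positivity
  have hKd : 2 ^ κ ≤ (2 ^ κ) ^ d := Nat.le_self_pow (by omega) _
  have hKAB : (2 ^ κ) ^ d ≤ 2 ^ ν * (2 ^ ν * (2 ^ μ) ^ 2) := by
    refine hκ1.trans ?_
    calc (N * M) ^ 2 ≤ (2 ^ ν * 2 ^ μ) ^ 2 := by gcongr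
      _ = _ := by ring
  have hBR : 2 ^ μ ≤ R ^ (2 * (μ + 1)) := by
    rw [hR_def, ← pow_mul]
    exact Nat.pow_le_pow_right (by norm_num) (by nlinarith)
  have hPZ : Z ^ (2 * (s + 1)) ≤ ((2 ^ κ * R ^ (2 * (s + 1) * (μ + 1)) : ℕ) : ℝ) := by
    rw [hZ_def]
    exact_mod_cast hRL.trans (Nat.le_mul_of_pos_left _ hK0)
  have hQZ : Z ^ (2 * (s + 1)) ≤ 2 ^ ((ν + 3) * ((s + 1) * (μ + 3))) := by
    rw [hZ_def]
    have : (N * M) ^ (2 * (s + 1)) ≤ 2 ^ ((ν + 3) * ((s + 1) * (μ + 3))) := by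
      calc (N * M) ^ (2 * (s + 1)) ≤ (2 ^ ν * 2 ^ μ) ^ (2 * (s + 1)) := by gcongr
        _ = 2 ^ (2 * (ν + μ) * (s + 1)) := by rw [← pow_add, ← pow_mul]; ring_nf
        _ ≤ 2 ^ ((ν + 3) * (μ + 3) * (s + 1)) := by
            refine Nat.pow_le_pow_right (by norm_num) (Nat.mul_le_mul_right _ ?_)
            nlinarith
        _ = _ := by ring_nf
    exact_mod_cast this
  have hcell : Z ^ 2 ≤ (2 * ((2 ^ κ : ℕ) : ℝ)) ^ d := by
    rw [hZ_def]
    exact_mod_cast hκ2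
  obtain ⟨w₀, w₁, w₂, w₃, w₄⟩ := branch_width_le hd hN hνN
  set E : ℝ := B₀ * (d : ℝ) ^ ((s : ℝ) + max β 1 / 2) * Z ^ (-2 * β / (d : ℝ)) with hE
  have hE0 : 0 ≤ E := by positivity
  -- `l` digits hold a cell coordinate, `L` digits an offset to precision `Z ^ (-2 * (s + 1))`. The
  -- `n * e` bits of a coefficient reach the same precision because `(ν + 3) * (μ + 3) ≥ 2 * (ν +
  -- μ)`.
  obtain ⟨g, hg, happ⟩ := exists_reach_approx hB₀ hr0 hf (A := 2 ^ ν) (B := 2 ^ μ) (R := R)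
    (l := 2 * (μ + 1)) (L := 2 * (s + 1) * (μ + 1)) (K := 2 ^ κ) (n := ν + 3)
    (e := (s + 1) * (μ + 3)) (W := 20 * d * N * (ν + 3)) (D := 21 * (s + 1) ^ 2 * M * (μ + 3))
    hR (by positivity) (by positivity) hK0 hBR (hKd.trans (hκ1.trans hRl)) hKAB w₀ w₁ w₂ w₃ w₄
    (fun k hk => depth_le hM hk hμM) (Ω := 2 * E)
    (fun x hx y hy hxy => abs_sub_le_of_close hd hr0 hr1 hβ hB₀ hf hZ hPZ hx hy hxy)
  set W₀ := 38 * (s + 1) ^ 2 * d ^ (s + 1) * N * (ν + 3) with hW₀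
  have hW : (∑ k ∈ Finset.range (s + 1), d ^ k) * (20 * d * N * (ν + 3)) ≤ W₀ := by
    calc (∑ k ∈ Finset.range (s + 1), d ^ k) * (20 * d * N * (ν + 3))
        ≤ ((s + 1) * d ^ s) * (20 * d * N * (ν + 3)) := by gcongr; exact sum_pow_le hd
      _ = 20 * (s + 1) * d ^ (s + 1) * N * (ν + 3) := by ring
      _ ≤ W₀ := by
          rw [hW₀]
          gcongr ?_ * _ * _ * _
          nlinarith
  have hW3 : 3 ≤ W₀ := by
    have h1 : 1 ≤ d ^ (s + 1) := Nat.one_le_pow _ _ hd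
    have h2 : 1 ≤ (s + 1) ^ 2 := Nat.one_le_pow _ _ (by omega)
    calc 3 ≤ 38 * 1 * 1 * 1 * (0 + 3) := by norm_num
      _ ≤ W₀ := by rw [hW₀]; gcongr; omega
  have hP0 : 0 < 2 ^ κ * R ^ (2 * (s + 1) * (μ + 1)) := by positivity
  obtain ⟨φ, hφ, hφf⟩ := ReLUCalculus.exists_median_network hW3 (hg.mono hW)
    (C := {x | WithLp.toLp 2 x ∈ unitCube d}) (F := fun x => f (WithLp.toLp 2 x))
    (by positivity) (cellGood_two_of_three hP0) happ
  obtain ⟨net, h1, h2, h3⟩ := hφ.exists_net_eq (by omega)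
  refine ⟨net, ?_, h2, fun x hx => ?_⟩
  · rw [h1, hW₀]; ring
  · have key := hφf (fun i => x i) hx
    rw [h3, abs_sub_comm]
    refine key.trans ?_
    have t1 := taylor_term_le hd hr0 hr1 hβ hB₀ hZ (by positivity : (0 : ℝ) < ((2 ^ κ : ℕ) : ℝ))
      hcell
    have t2 := quantization_term_le hd hr0 hr1 hβ hB₀ hZ hQZ
    rw [← hE] at t1 t2
    have hs : (0 : ℝ) ≤ s := Nat.cast_nonneg s
    have t3 : 19 * B₀ * ((s : ℝ) + 1) ^ 2 * (d : ℝ) ^ ((s : ℝ) + (max β 1) / 2) *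
        Z ^ (-2 * β / (d : ℝ)) = 19 * ((s : ℝ) + 1) ^ 2 * E := by rw [hE]; ring
    rw [t3]
    -- The three contributions come from the Taylor remainder, the rounded coefficients and the
    -- rounded point.
    have t4 : (4 + 2 * ((s : ℝ) + 1) + 2) * E ≤ 19 * ((s : ℝ) + 1) ^ 2 * E := by
      gcongr
      nlinarith
    linarith
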